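/- A Boolean relation $R\subseteq\{0,1\}^r$ is \emph{OR-conj} (respectively \emph{NAND-conj}) if it is defined by a conjunction of pins ($x_i=0$ or $x_i=1$) and clauses that are ORs (respectively NANDs) of variables, of any arity. Such a formula is \emph{normalized} if no variable is pinned to both values, no pinned variable appears in a clause, the arguments of each clause are distinct, every clause has at least two arguments, and no clause's set of arguments is contained in another's. A non-empty OR-conj (respectively NAND-conj) relation is defined by exactly one normalized formula (up to order and repetition of pins and order within and among clauses); its \emph{width} is the greatest number of arguments of a clause of that formula, or $0$ if there are no clauses. The empty relation is given width $0$. For a finite set $\Gamma$ of named Boolean relations, $\#\mathrm{CSP}_d(\Gamma)$ is the following problem: given a finite set $V$ of variables and a set $C$ of constraints $S(v_1,\dots,v_k)$ with $S\in\Gamma$ of arity $k$ and $v_1,\dots,v_k\in V$ (not necessarily distinct), such that every variable appears at most $d$ times in total in the scopes of the constraints (with multiplicity), compute the number of assignments $V\to\{0,1\}$ that satisfy all constraints. Let $\Gamma_{\mathrm{pin}}=\{R_{\mathrm{zero}},R_{\mathrm{one}}\}$ with $R_{\mathrm{zero}}=\{0\}$ and $R_{\mathrm{one}}=\{1\}$.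 The problem $\#w\text{-}\mathrm{HIS}_d$ is: given a finite hypergraph whose hyperedges are non-empty and have at most $w$ vertices and in which every vertex lies in at most $d$ hyperedges, compute the number of its independent sets, i.e. of sets of vertices that include no hyperedge. A \emph{randomized approximation scheme} for a counting problem $f$ produces, on an instance $x$ and an error parameter $\epsilon\in(0,1)$, a random integer $Y$ with $\Pr\bigl(e^{-\epsilon}f(x)\le Y\le e^{\epsilon}f(x)\bigr)\ge\frac34$. An \emph{AP-reduction} from $f$ to $g$ is a probabilistic oracle Turing machine that takes as input an instance $x$ of $f$ and $\epsilon\in(0,1)$ (as a finite binary expansion) such that (i) every oracle call is of the form $(y,\delta)$ with $y$ an instance of $g$ and $0<\delta<1$, $\delta^{-1}\le\mathrm{poly}(|x|,\epsilon^{-1})$; (ii) the machine is a randomized approximation scheme for $f$ whenever the oracle is a randomized approximation scheme for $g$; and (iii) its run-time is polynomial in $|x|$ and $\epsilon^{-1}$. Write $f\le_{\mathrm{AP}}g$ if there is one. \textbf{Proposition.} Let $R$ be an OR-conj or NAND-conj relation of width $w$. Then for every $d\ge 2$, $$\#w\text{-}\mathrm{HIS}_d\ \le_{\mathrm{AP}}\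 \#\mathrm{CSP}_d(\{R\}\cup\Gamma_{\mathrm{pin}}).$$ -/

import Mathlib

/-! # Boolean counting CSPs, hypergraph independent sets and approximation-preserving reductions -/

namespace BoundedCSP

/-! ## Strings and counting problems -/

/-- The string alphabet `Σ`: two bits and a separator. -/
inductive Sym
  | bit (b : Bool)
  | bar
  deriving DecidableEq, Fintype

/-- A unary block of `k` ones. -/
def ones (k : ℕ) : List Sym := List.replicate k (Sym.bit true)

/-- The name of a variable in unary, closed by a zero. -/
def varCode {n : ℕ} (v : Fin n) : List Sym := ones v.val ++ [Sym.bit false]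

/-- A counting problem: a function to `ℕ` defined on those strings over `Σ` that encode instances. -/
structure CountingProblem where
  Instance : Type
  code : Instance → List Sym
  code_injective : Function.Injective code
  count : Instance → ℕ

/-- Binary encoding of an integer: a separator as minus sign if it is negative, then the bits of the
absolute value, least significant bit first. -/
def encodeInt (y : ℤ) : List Sym :=
  (if y < 0 then [Sym.bar] else []) ++ (Nat.bits y.natAbs).map Sym.bit

/-- The number `0.b₁b₂…` with the given binary digits (a separator is read as the digit `0`). -/
noncomputable def binVal : List Sym → ℝ
  | [] => 0
  | s :: l => ((if s = Sym.bit true then 1 else 0) + binVal l) / 2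

/-- Strings that denote an error parameter: finite strings of bits whose value `0.b₁b₂…` lies in the
open interval `(0, 1)`. -/
def IsErrorString (e : List Sym) : Prop :=
  (∀ s ∈ e, s ≠ Sym.bar) ∧ 0 < binVal e ∧ binVal e < 1

/-! ## Probabilistic oracle Turing machines -/

/-- The instruction at a label: an ordinary Turing machine statement, a fair coin toss that selects
the next label, or an oracle call followed by a jump. -/
inductive Instr (K Λ σ : Type)
  | det (s : Turing.TM2.Stmt (fun _ : K => Sym) Λ σ)
  | coin (l₀ l₁ : Λ)
  | query (l : Λ)

/-- A probabilistic oracle Turing machine: Mathlib's Turing machine with finitely many stacks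
(`Turing.TM2`; a tape is a pair of stacks), finitely many labels and a finite internal memory,
extended by coin tosses and oracle calls. The machine designates the stacks on which it finds its
input string and its error parameter, those on which it writes the string and the error
parameter of an oracle call, the one on which the oracle writes its answer, and the one on which it
leaves its output. -/
structure OracleTM where
  K : Type
  [decK : DecidableEq K]
  [finK : Finite K]
  Λ : Type
  [finΛ : Finite Λ]
  σ : Type
  [finσ : Finite σ]
  main : Λ
  init : σ
  prog : Λ → Instr K Λ σ
  inputStk : K
  errorStk : K
  queryStk : K
  queryErrorStk : K
  answerStk : K
  outputStk : K

attribute [instance] OracleTM.decK OracleTM.finK OracleTM.finΛ OracleTM.finσ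

/-- An oracle: for every call `(w, δ)`, the distribution of its random integer answer. -/
abbrev Oracle := List Sym → ℝ → PMF ℤ

namespace OracleTM

variable (M : OracleTM)

abbrev Cfg := Turing.TM2.Cfg (fun _ : M.K => Sym) M.Λ M.σ

/-- The initial configuration on input `x` with error parameter `e`. -/
def start (x e : List Sym) : M.Cfg where
  l := some M.main
  var := M.init
  stk := Function.update (Function.update (fun _ => []) M.inputStk x) M.errorStk e

/-- The distribution of the next configuration; halted configurations stay as they are. Each oracle
call is answered by a fresh sample. -/
noncomputable def step (O : Oracle) (c : M.Cfg) : PMF M.Cfg :=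
  match c.l with
  | none => PMF.pure c
  | some l =>
    match M.prog l with
    | .det s => PMF.pure (Turing.TM2.stepAux s c.var c.stk)
    | .coin l₀ l₁ => (PMF.uniformOfFintype Bool).map fun b =>
        { c with l := some (if b then l₁ else l₀) }
    | .query l' => (O (c.stk M.queryStk) (binVal (c.stk M.queryErrorStk))).map fun y =>
        { l := some l', var := c.var, stk := Function.update c.stk M.answerStk (encodeInt y) }

/-- The distribution of the configuration after `t` steps from `c`. -/
noncomputable def run (O : Oracle) : ℕ → M.Cfg → PMF M.Cfg
  | 0, c => PMF.pure c
  | t + 1, c => (M.step O c).bind (run O t)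

/-- The configuration is about to call the oracle. -/
def AtQuery (c : M.Cfg) : Prop := ∃ l l', c.l = some l ∧ M.prog l = .query l'

end OracleTM

/-! ## Approximation-preserving reductions -/

/-- `exp(-ε) ≤ y / z ≤ exp(ε)`, in a form that for `z = 0` means `y = 0`. -/
def Approximates (ε : ℝ) (z : ℕ) (y : ℤ) : Prop :=
  Real.exp (-ε) * z ≤ y ∧ (y : ℝ) ≤ Real.exp ε * z

/-- The oracle answers like a randomized approximation scheme for `g`. -/
def Oracle.IsRAS (O : Oracle) (g : CountingProblem) : Prop :=
  ∀ (J : g.Instance) (δ : ℝ), 0 < δ → δ < 1 →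
    3 / 4 ≤ (O (g.code J) δ).toOuterMeasure {y | Approximates δ (g.count J) y}

/-- `M` is an approximation-preserving reduction from `f` to `g`. The bound
`C * (|x| + ε⁻¹) ^ k` is polynomial in the length `|x|` of the input and in `ε⁻¹`. The conditions
on the oracle calls and on the run-time hold on every computation path, whatever the oracle. -/
def IsAPReduction (M : OracleTM) (f g : CountingProblem) : Prop :=
  ∃ C k : ℕ, ∀ (I : f.Instance) (e : List Sym), IsErrorString e →
    let bound : ℝ := C * ((f.code I).length + (binVal e)⁻¹) ^ k
    let c₀ := M.start (f.code I) e
    -- every oracle call is of the form `(w, δ)`, `w` an instance of `g`, `δ⁻¹` polynomial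
    (∀ (O : Oracle) (t : ℕ), ∀ c ∈ (M.run O t c₀).support, M.AtQuery c →
      (∃ J : g.Instance, c.stk M.queryStk = g.code J) ∧
      IsErrorString (c.stk M.queryErrorStk) ∧ (binVal (c.stk M.queryErrorStk))⁻¹ ≤ bound) ∧
    ∃ T : ℕ,
      -- the run-time is polynomial
      (T : ℝ) ≤ bound ∧
      (∀ O : Oracle, ∀ c ∈ (M.run O T c₀).support, c.l = none) ∧
      -- the output approximates `f` whenever the oracle is a randomized approximation scheme
      (∀ O : Oracle, O.IsRAS g →
        3 / 4 ≤ (M.run O T c₀).toOuterMeasure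
          {c | ∃ y : ℤ, c.stk M.outputStk = encodeInt y ∧
            Approximates (binVal e) (f.count I) y})

/-- `f` is AP-reducible to `g`. -/
def APReducible (f g : CountingProblem) : Prop := ∃ M : OracleTM, IsAPReduction M f g

/-! ## Boolean relations, constraint languages and counting CSPs -/

/-- A Boolean relation together with its arity. -/
structure BoolRel where
  arity : ℕ
  rel : Set (Fin arity → Bool)

/-- `{0}` and `{1}`. -/
def Rzero : BoolRel := ⟨1, {a | a 0 = false}⟩
def Rone : BoolRel := ⟨1, {a | a 0 = true}⟩

/-- A constraint language: a finite family of named Boolean relations, the names being the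
positions in the list. -/
abbrev Language := List BoolRel

def pins : Language := [Rzero, Rone]

/-- A constraint over `Γ` with variables from `V`; the scope may have repetitions. -/
@[ext]
structure Constraint (Γ : Language) (V : Type) where
  name : Fin Γ.length
  scope : Fin (Γ.get name).arity → V

namespace Constraint

variable {Γ : Language} {V : Type}

def Satisfied (c : Constraint Γ V) (τ : V → Bool) : Prop :=
  (fun i => τ (c.scope i)) ∈ (Γ.get c.name).rel

/-- The number of times that `v` appears in the scope. -/
def occ [DecidableEq V] (c : Constraint Γ V) (v : V) : ℕ :=
  (Finset.univ.filter fun i => c.scope i = v).card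

/-- The name of the relation in unary, then the names of the variables of the scope in unary, each
closed by a zero; then a separator. -/
def code {n : ℕ} (c : Constraint Γ (Fin n)) : List Sym :=
  ones c.name.val ++ Sym.bit false ::
    ((List.ofFn c.scope).flatMap varCode ++ [Sym.bar])

end Constraint

/-- An instance of degree at most `d` over `Γ`: variables `0, …, n - 1` and a set of constraints,
given as a list without repetitions. -/
@[ext]
structure CSPInstance (d : ℕ) (Γ : Language) where
  n : ℕ
  constraints : List (Constraint Γ (Fin n))
  nodup : constraints.Nodup
  degree_le : ∀ v, (constraints.map fun c => c.occ v).sum ≤ d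

namespace CSPInstance

variable {d : ℕ} {Γ : Language}

/-- The number `Z(I)` of satisfying assignments. -/
noncomputable def Z (I : CSPInstance d Γ) : ℕ :=
  Set.ncard {τ : Fin I.n → Bool | ∀ c ∈ I.constraints, c.Satisfied τ}

/-- The number of variables in unary and a separator, then the constraints. -/
def code (I : CSPInstance d Γ) : List Sym :=
  ones I.n ++ Sym.bar :: I.constraints.flatMap Constraint.code

end CSPInstance

/-! ## Hypergraphs and independent sets -/

/-- A set of vertices that includes no hyperedge. -/
def IsIndependent {V : Type} (H : Hypergraph V) (S : Set V) : Prop :=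
  S ⊆ H.vertexSet ∧ ∀ e ∈ H.edgeSet, ¬ e ⊆ S

/-- The number of hyperedges that contain `v`. -/
noncomputable def hdegree {V : Type} (H : Hypergraph V) (v : V) : ℕ :=
  Set.ncard {e ∈ H.edgeSet | v ∈ e}

/-- The hypergraph with vertices `0, …, n - 1` and the listed hyperedges. -/
def listedHypergraph {n : ℕ} (edges : List (Finset (Fin n))) : Hypergraph (Fin n) where
  vertexSet := Set.univ
  edgeSet := {e | ∃ e' ∈ edges, e = (e' : Set (Fin n))}
  subset_vertexSet_of_mem_edgeSet' := fun e _ => Set.subset_univ e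

/-- A hypergraph with non-empty hyperedges of at most `w` vertices and with degree at most `d`,
given by its number of vertices and a list without repetitions of its hyperedges. (Hypergraphs whose
largest hyperedge has exactly `w` vertices are among these.) -/
@[ext]
structure HISInstance (w d : ℕ) where
  n : ℕ
  edges : List (Finset (Fin n))
  nodup : edges.Nodup
  nonempty : ∀ e ∈ (listedHypergraph edges).edgeSet, e.Nonempty
  width_le : ∀ e ∈ (listedHypergraph edges).edgeSet, e.ncard ≤ w
  degree_le : ∀ v, hdegree (listedHypergraph edges) v ≤ d

/-- A hyperedge as its 0-1 incidence vector, closed by a separator. -/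
def edgeCode {n : ℕ} (e : Finset (Fin n)) : List Sym :=
  List.ofFn (fun v => Sym.bit (decide (v ∈ e))) ++ [Sym.bar]

namespace HISInstance

variable {w d : ℕ}

noncomputable def count (H : HISInstance w d) : ℕ :=
  Set.ncard {S : Set (Fin H.n) | IsIndependent (listedHypergraph H.edges) S}

/-- The number of vertices in unary and a separator, then the incidence matrix row by row. -/
def code (H : HISInstance w d) : List Sym :=
  ones H.n ++ Sym.bar :: H.edges.flatMap edgeCode

end HISInstance

/-! ### The encodings are injective -/

/-- A block of ones is determined by the string if it is followed by something else. -/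
theorem ones_append_inj {s : Sym} (hs : s ≠ Sym.bit true) :
    ∀ {a b : ℕ} {u v : List Sym}, ones a ++ s :: u = ones b ++ s :: v → a = b ∧ u = v := by
  intro a
  induction a with
  | zero =>
    rintro (_ | b) u v h
    · simpa [ones] using h
    · simp [ones, List.replicate_succ] at h
      exact absurd h.1 hs
  | succ a ih =>
    rintro (_ | b) u v h
    · simp [ones, List.replicate_succ] at h
      exact absurd h.1.symm hs
    · simp only [ones, List.replicate_succ, List.cons_append, List.cons.injEq, true_and] at h
      obtain ⟨h₁, h₂⟩ := ih h
      exact ⟨by omega, h₂⟩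

theorem flatMap_inj_of_prefix {α : Type} (F : α → List Sym) (hne : ∀ a, F a ≠ [])
    (hF : ∀ a b u v, F a ++ u = F b ++ v → a = b ∧ u = v) :
    ∀ l l' : List α, l.flatMap F = l'.flatMap F → l = l'
  | [], [], _ => rfl
  | [], b :: l', h => by
    have := congrArg List.length h
    have hb := List.length_pos_iff.2 (hne b)
    simp only [List.flatMap_nil, List.flatMap_cons, List.length_append, List.length_nil] at this
    omega
  | a :: l, [], h => by
    have := congrArg List.length h
    have hb := List.length_pos_iff.2 (hne a)
    simp only [List.flatMap_nil, List.flatMap_cons, List.length_append, List.length_nil] at this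
    omega
  | a :: l, b :: l', h => by
    obtain ⟨rfl, h'⟩ := hF _ _ _ _ h
    rw [flatMap_inj_of_prefix F hne hF l l' h']

theorem edgeCode_append_inj {n : ℕ} (e e' : Finset (Fin n)) (u v : List Sym)
    (h : edgeCode e ++ u = edgeCode e' ++ v) : e = e' ∧ u = v := by
  have h' := List.append_inj h (by simp [edgeCode])
  refine ⟨?_, h'.2⟩
  have h₁ := List.append_inj_left' h'.1 rfl
  rw [List.ofFn_inj] at h₁
  ext v
  have := congrFun h₁ v
  simpa using this

theorem HISInstance.code_injective (w d : ℕ) :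
    Function.Injective (HISInstance.code (w := w) (d := d)) := by
  rintro ⟨n, E, h₁, h₂, h₃, h₄⟩ ⟨n', E', h₁', h₂', h₃', h₄'⟩ h
  obtain ⟨hn, hE⟩ := ones_append_inj (by simp) h
  dsimp only at hn hE
  subst hn
  have := flatMap_inj_of_prefix edgeCode (by simp [edgeCode]) edgeCode_append_inj E E' hE
  subst this
  rfl

theorem scopeCode_append_inj {n : ℕ} : ∀ {m : ℕ} (s s' : Fin m → Fin n) (u v : List Sym),
    (List.ofFn s).flatMap varCode ++ u =
      (List.ofFn s').flatMap varCode ++ v → s = s' ∧ u = v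
  | 0, s, s', u, v, h => ⟨Subsingleton.elim _ _, by simpa using h⟩
  | m + 1, s, s', u, v, h => by
    simp only [List.ofFn_succ, List.flatMap_cons, varCode, List.append_assoc,
      List.singleton_append] at h
    obtain ⟨h₀, h⟩ := ones_append_inj (by simp) h
    obtain ⟨h₁, h₂⟩ := scopeCode_append_inj _ _ _ _ h
    refine ⟨funext fun i => ?_, h₂⟩
    cases i using Fin.cases with
    | zero => exact Fin.ext h₀
    | succ i => exact congrFun h₁ i

theorem Constraint.code_append_inj {Γ : Language} {n : ℕ} (c c' : Constraint Γ (Fin n))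
    (u v : List Sym) (h : c.code ++ u = c'.code ++ v) : c = c' ∧ u = v := by
  obtain ⟨i, s⟩ := c
  obtain ⟨i', s'⟩ := c'
  simp only [Constraint.code, List.append_assoc, List.cons_append] at h
  obtain ⟨h₀, h⟩ := ones_append_inj (by simp) h
  have h₀ := Fin.ext h₀
  subst h₀
  obtain ⟨rfl, h⟩ := scopeCode_append_inj _ _ _ _ h
  exact ⟨rfl, by simpa using h⟩

theorem CSPInstance.code_injective (d : ℕ) (Γ : Language) :
    Function.Injective (CSPInstance.code (d := d) (Γ := Γ)) := by
  rintro ⟨n, E, h₁, h₂⟩ ⟨n', E', h₁', h₂'⟩ h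
  obtain ⟨hn, hE⟩ := ones_append_inj (by simp) h
  dsimp only at hn hE
  subst hn
  have := flatMap_inj_of_prefix Constraint.code (by simp [Constraint.code])
    Constraint.code_append_inj E E' hE
  subst this
  rfl

/-- The problem `#CSP_d(Γ)`. -/
noncomputable def numCSP (d : ℕ) (Γ : Language) : CountingProblem where
  Instance := CSPInstance d Γ
  code := CSPInstance.code
  code_injective := CSPInstance.code_injective d Γ
  count := CSPInstance.Z

/-- The problem `#w-HIS_d`. -/
noncomputable def numHIS (w d : ℕ) : CountingProblem where
  Instance := HISInstance w d
  code := HISInstance.code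
  code_injective := HISInstance.code_injective w d
  count := HISInstance.count

/-! ## OR-conj and NAND-conj relations and their width -/

/-- A conjunction of pins `xᵢ = c` and of clauses in the variables `x₀, …, x_{r-1}`; a clause is the
list of the arguments of an `OR`, or of a `NAND`. -/
structure ConjFormula (r : ℕ) where
  pinned : List (Fin r × Bool)
  clauses : List (List (Fin r))

namespace ConjFormula

variable {r : ℕ} (φ : ConjFormula r)

/-- The relation defined by the formula when its clauses are read as `OR`s. -/
def orRel : Set (Fin r → Bool) :=
  {a | (∀ p ∈ φ.pinned, a p.1 = p.2) ∧ ∀ C ∈ φ.clauses, ∃ i ∈ C, a i = true}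

/-- The relation defined by the formula when its clauses are read as `NAND`s. -/
def nandRel : Set (Fin r → Bool) :=
  {a | (∀ p ∈ φ.pinned, a p.1 = p.2) ∧ ∀ C ∈ φ.clauses, ¬ ∀ i ∈ C, a i = true}

/-- Normalized formulas: no variable is pinned to both values, no pinned variable appears in a
clause, the arguments of each clause are distinct, every clause has at least two arguments, and no
clause's arguments are a subset of another's. -/
def Normalized : Prop :=
  (∀ i, ¬ ((i, false) ∈ φ.pinned ∧ (i, true) ∈ φ.pinned)) ∧
  (∀ p ∈ φ.pinned, ∀ C ∈ φ.clauses, p.1 ∉ C) ∧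
  (∀ C ∈ φ.clauses, C.Nodup) ∧
  (∀ C ∈ φ.clauses, 2 ≤ C.length) ∧
  φ.clauses.Pairwise fun C D => ¬ C ⊆ D ∧ ¬ D ⊆ C

/-- The greatest number of arguments of a clause (`0` if there is no clause). -/
def width : ℕ := (φ.clauses.map List.length).foldr max 0

end ConjFormula

/-- The OR-conj relations of arity `r`. -/
def ORConj (r : ℕ) : Set (Set (Fin r → Bool)) := {R | ∃ φ : ConjFormula r, φ.orRel = R}

/-- The NAND-conj relations of arity `r`. -/
def NANDConj (r : ℕ) : Set (Set (Fin r → Bool)) := {R | ∃ φ : ConjFormula r, φ.nandRel = R}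

/-- The width of an OR-conj relation `R`: the width of the normalized formula that defines it. For
`R ≠ ∅` that formula is unique up to order, so the set below has exactly one element; the empty
relation has no normalized formula, and gets width `0`. -/
noncomputable def orWidth {r : ℕ} (R : Set (Fin r → Bool)) : ℕ :=
  sInf {w | ∃ φ : ConjFormula r, φ.Normalized ∧ φ.orRel = R ∧ φ.width = w}

/-- The width of a NAND-conj relation, likewise. -/
noncomputable def nandWidth {r : ℕ} (R : Set (Fin r → Bool)) : ℕ :=
  sInf {w | ∃ φ : ConjFormula r, φ.Normalized ∧ φ.nandRel = R ∧ φ.width = w}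

end BoundedCSP

/-! The reduction is parsimonious. It turns a hypergraph into a CSP instance with exactly as many
satisfying assignments as there are independent sets, asks the oracle once with the same error
parameter, and returns the answer.

The relation `R` is used through a widest clause `C` of its normalized formula. Let `t` be true for
OR and false for NAND, so that a clause says that some argument equals `t`. Give each position
outside `C` its pinned value, or `t` if it is not pinned. This respects all pins. It also satisfies
every other clause, because clauses form an antichain: another clause has an argument outside `C`,
and that argument is unpinned. What remains of `R` is "some position of `C` equals `t`". This is
`ConjFormula.Normalized.exists_simulates`, with `mask` for `C` and `p` for the values; on the mask
`p` is `!t`, the neutral value of the clause.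

A hyperedge has at most `w` vertices, so they fit into the masked positions. Each hyperedge gets a
constraint `R` and a block of `r` new variables pinned according to `p`; these fill all positions
that receive no vertex. The constraint then says that some vertex of the hyperedge has value `t`.
Hence `{v | τ v ≠ t}` is independent exactly when these constraints hold, and the new variables are
determined (`rowsCons_satisfied`, `HISInstance.Z_toCSP`). A vertex occurs once for each of its
hyperedges. A new variable occurs at most twice, in its pin and in one scope; this is where `2 ≤ d`
enters. Distinct hyperedges give distinct constraints (`rowCon_inj`), so the list of constraints has
no repetitions. For `w = 0` there are no hyperedges, and nothing is needed of `R`.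

The other half is an explicit machine that writes the code of this instance in quadratic time
(`reach_ask`). It pushes its output on a stack, so the string is produced from its end: this is why
rows, positions and pins are handled in reverse. `flatMap_natCode_rowsCons` identifies the string
with the code of the instance, and `isAPReduction_of_parsimonious` concludes. -/

namespace BoundedCSP

/-! ## Deterministic stretches of a run -/

namespace OracleTM

variable {M : OracleTM}

/-- `M` gets from one configuration to another in `t` steps that neither toss a coin nor call the
oracle. -/
inductive DetReach (M : OracleTM) : ℕ → M.Cfg → M.Cfg → Prop
  | refl (c : M.Cfg) : DetReach M 0 c c
  | step {t : ℕ} {c c' : M.Cfg} (l : M.Λ) (s) (hl : c.l = some l) (hs : M.prog l = .det s)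
      (h : DetReach M t (Turing.TM2.stepAux s c.var c.stk) c') : DetReach M (t + 1) c c'

theorem step_det (O : Oracle) {c : M.Cfg} {l : M.Λ} {s} (hl : c.l = some l)
    (hs : M.prog l = .det s) : M.step O c = PMF.pure (Turing.TM2.stepAux s c.var c.stk) := by
  simp only [step, hl, hs]

theorem DetReach.run_add {t : ℕ} {c c' : M.Cfg} (h : DetReach M t c c') (O : Oracle) (s : ℕ) :
    M.run O (t + s) c = M.run O s c' := by
  induction h with
  | refl c => rw [Nat.zero_add]
  | step l q hl hq _ ih => rw [Nat.add_right_comm, run, step_det O hl hq, PMF.pure_bind, ih]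

/-- No configuration passed before the end of a deterministic stretch is about to call the oracle,
so the conditions on oracle calls need checking only from `c'` on. -/
theorem DetReach.exists_mem_support {t : ℕ} {c c' : M.Cfg} (h : DetReach M t c c') (O : Oracle)
    {s : ℕ} {x : M.Cfg} (hx : x ∈ (M.run O s c).support) (hq : M.AtQuery x) :
    ∃ s', x ∈ (M.run O s' c').support := by
  induction h generalizing s with
  | refl c => exact ⟨s, hx⟩
  | step l q hl hs _ ih =>
    cases s with
    | zero =>
      obtain rfl : x = _ := by simpa [run] using hx
      obtain ⟨l₁, l₂, h₁, h₂⟩ := hq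
      rw [hl] at h₁
      obtain rfl := Option.some.inj h₁
      simp [hs] at h₂
    | succ s =>
      rw [run, step_det O hl hs, PMF.pure_bind] at hx
      exact ih hx

theorem DetReach.trans {t t' : ℕ} {a b c : M.Cfg} (h : DetReach M t a b)
    (h' : DetReach M t' b c) : DetReach M (t + t') a c := by
  induction h with
  | refl => simpa using h'
  | step l s hl hs _ ih => rw [Nat.add_right_comm]; exact .step l s hl hs (ih h')

/-- `M` gets from one configuration to another in at most `B` deterministic steps. -/
def ReachLE (M : OracleTM) (B : ℕ) (c c' : M.Cfg) : Prop := ∃ t ≤ B, DetReach M t c c'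

theorem ReachLE.refl (c : M.Cfg) : ReachLE M 0 c c := ⟨0, le_rfl, .refl c⟩

theorem ReachLE.trans {B B' : ℕ} {a b c : M.Cfg} (h : ReachLE M B a b)
    (h' : ReachLE M B' b c) : ReachLE M (B + B') a c := by
  obtain ⟨t, ht, h⟩ := h
  obtain ⟨t', ht', h'⟩ := h'
  exact ⟨t + t', Nat.add_le_add ht ht', h.trans h'⟩

theorem ReachLE.mono {B B' : ℕ} {a b : M.Cfg} (h : ReachLE M B a b) (hB : B ≤ B') :
    ReachLE M B' a b := by
  obtain ⟨t, ht, h⟩ := h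
  exact ⟨t, ht.trans hB, h⟩

theorem run_of_l_eq_none (O : Oracle) {c : M.Cfg} (h : c.l = none) (t : ℕ) :
    M.run O t c = PMF.pure c := by
  induction t with
  | zero => rfl
  | succ t ih => rw [run]; simp only [step, h, PMF.pure_bind, ih]

end OracleTM

/-! ### Parsimonious reductions are AP-reductions -/

theorem one_lt_inv_binVal {e : List Sym} (he : IsErrorString e) : 1 < (binVal e)⁻¹ :=
  (one_lt_inv₀ he.2.1).2 he.2.2

/-- A machine that computes from an instance `I` of `f` an instance of `g` with the same count, calls
the oracle once on it with the given error parameter and returns the answer is an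
approximation-preserving reduction. -/
theorem isAPReduction_of_parsimonious (M : OracleTM) (f g : CountingProblem)
    (F : f.Instance → g.Instance) (hF : ∀ I, g.count (F I) = f.count I)
    (ask final : M.Λ) (hask : M.prog ask = .query final) (hfinal : M.prog final = .det .halt)
    (hout : M.outputStk = M.answerStk)
    (C : ℕ) (hM : ∀ I e, ∃ c : M.Cfg, c.l = some ask ∧ c.stk M.queryStk = g.code (F I) ∧
      c.stk M.queryErrorStk = e ∧
      M.ReachLE (C * (f.code I).length ^ 2) (M.start (f.code I) e) c) :
    IsAPReduction M f g := by
  -- The extra 3 leaves room for the two steps after the deterministic stretch (the call and the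
  -- halt) and, separately, for the inverse of the error parameter. It suffices because the base of
  -- the power exceeds 1.
  refine ⟨C + 3, 2, fun I e he => ?_⟩
  obtain ⟨c, hl, hq, hqe, t, ht, hc⟩ := hM I e
  have h1 := one_lt_inv_binVal he
  have hL : (0 : ℝ) ≤ (f.code I).length := Nat.cast_nonneg _
  have hC : (0 : ℝ) ≤ C := Nat.cast_nonneg _
  have ht' : (t : ℝ) ≤ C * ((f.code I).length : ℝ) ^ 2 := by exact_mod_cast ht
  have hsq : (1 : ℝ) ≤ ((f.code I).length + (binVal e)⁻¹) ^ 2 := one_le_pow₀ (by linarith)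
  have hinv : (binVal e)⁻¹ ≤ ((f.code I).length + (binVal e)⁻¹) ^ 2 := by nlinarith
  have hmono : ((f.code I).length : ℝ) ^ 2 ≤ ((f.code I).length + (binVal e)⁻¹) ^ 2 := by
    gcongr; linarith
  have hb : (C : ℝ) * ((f.code I).length : ℝ) ^ 2 + 3 * ((f.code I).length + (binVal e)⁻¹) ^ 2 ≤
      ((C + 3 : ℕ) : ℝ) * ((f.code I).length + (binVal e)⁻¹) ^ 2 := by
    push_cast
    nlinarith [mul_le_mul_of_nonneg_left hmono hC]
  have hCL : (0 : ℝ) ≤ C * ((f.code I).length : ℝ) ^ 2 := by positivity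
  have hrun (O : Oracle) (s : ℕ) : M.run O (s + 2) c = (O (g.code (F I)) (binVal e)).map fun y =>
      ⟨none, c.var, Function.update c.stk M.answerStk (encodeInt y)⟩ := by
    rw [OracleTM.run]
    simp only [OracleTM.step, hl, hask, hq, hqe, PMF.map, PMF.bind_bind, Function.comp_def,
      PMF.pure_bind]
    congr 1
    funext y
    rw [OracleTM.run, OracleTM.step_det (l := final) (s := .halt) O rfl hfinal, PMF.pure_bind]
    exact OracleTM.run_of_l_eq_none O rfl s
  refine ⟨fun O s x hx hxq => ?_, t + 2, ?_, fun O x hx => ?_, fun O hO => ?_⟩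
  · obtain ⟨s', hs'⟩ := hc.exists_mem_support O hx hxq
    -- The only calling configuration from `c` on is `c` itself: one step later the machine is at
    -- `final`, and from then on it has halted.
    have : x = c := by
      obtain ⟨l, l', h₁, h₂⟩ := hxq
      match s', hs' with
      | 0, hs' => simpa [OracleTM.run] using hs'
      | 1, hs' =>
        rw [OracleTM.run] at hs'
        simp only [OracleTM.step, hl, hask, PMF.map, PMF.bind_bind, Function.comp_def,
          PMF.pure_bind, OracleTM.run, PMF.mem_support_bind_iff, PMF.support_pure,
          Set.mem_singleton_iff] at hs'
        obtain ⟨y, -, rfl⟩ := hs'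
        obtain rfl := Option.some.inj h₁
        simp [hfinal] at h₂
      | s + 2, hs' =>
        rw [hrun, PMF.mem_support_map_iff] at hs'
        obtain ⟨y, -, rfl⟩ := hs'
        simp at h₁
    subst this
    rw [hqe]
    exact ⟨⟨F I, hq⟩, he, by linarith⟩
  · push_cast at hb ⊢
    linarith
  · rw [hc.run_add, hrun O 0, PMF.mem_support_map_iff] at hx
    obtain ⟨y, -, rfl⟩ := hx
    rfl
  · rw [hc.run_add, hrun O 0, PMF.toOuterMeasure_map_apply]
    refine (hO (F I) (binVal e) he.2.1 he.2.2).trans (MeasureTheory.measure_mono fun y hy => ?_)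
    rw [hF I] at hy
    exact ⟨y, by simp [hout], hy⟩

/-! ## The strings to be computed -/

/-- The positions of the ones in a list of bits, counted from `g` on. -/
def truePositions : List Bool → ℕ → List ℕ
  | [], _ => []
  | true :: l, g => g :: truePositions l (g + 1)
  | false :: l, g => truePositions l (g + 1)

/-- The arguments at the positions `0, …, k - 1` of a scope: from the last position on, the masked
positions get the listed vertices as long as there are any; every other position `i` gets the
variable `b + i`. -/
def scopeNames (mask : ℕ → Bool) (b : ℕ) : ℕ → List ℕ → List ℕ
  | 0, _ => []
  | k + 1, vs =>
    match mask k, vs with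
    | true, v :: vs => scopeNames mask b k vs ++ [v]
    | _, vs => scopeNames mask b k vs ++ [b + k]

/-- The name of a variable in unary, closed by a zero. -/
def natCode (v : ℕ) : List Sym := ones v ++ [Sym.bit false]

/-- The code of a constraint with the given index of the relation and the given names of variables. -/
def rawCode (name : ℕ) (scope : List ℕ) : List Sym :=
  ones name ++ Sym.bit false :: (scope.flatMap natCode ++ [Sym.bar])

/-- The index of the relation that pins a variable to `c`. -/
def pinName (c : Bool) : ℕ := if c then 2 else 1

/-- The codes of the pins of the variables `b, …, b + k - 1`. -/
def pinsCode (p : ℕ → Bool) (b k : ℕ) : List Sym :=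
  (List.range k).flatMap fun i => rawCode (pinName (p i)) [b + i]

/-- The codes of the constraints for the rows of an incidence matrix. -/
def rowsCode (r : ℕ) (mask p : ℕ → Bool) : List (List Bool) → ℕ → List Sym
  | [], _ => []
  | bs :: E, b => rowsCode r mask p E (b + r) ++
      (pinsCode p b r ++ rawCode 0 (scopeNames mask b r (truePositions bs 0)))

/-! ## The machine -/

/-- The stacks of the machine: the input, the error parameter, two unary counters (the number of the
variables named so far and the position in the current row), a scratch stack used in copying a
counter, and the oracle call. -/
inductive Stk
  | io | err | base | pos | aux | out
  deriving DecidableEq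

instance : Fintype Stk := ⟨{.io, .err, .base, .pos, .aux, .out}, fun k => by cases k <;> simp⟩

/-- What a counter is copied for: to name a vertex, to name a new variable in a scope, or to name a
new variable in a pin. -/
inductive NameKind
  | vertex | fresh | pin
  deriving DecidableEq

instance : Fintype NameKind := ⟨{.vertex, .fresh, .pin}, fun m => by cases m <;> simp⟩

/-- The labels of the machine. -/
inductive Lab (r : ℕ)
  | init | row
  | scan (i : Fin r)
  | copy (m : NameKind) (i : Fin r)
  | restore (m : NameKind) (i : Fin r)
  | skip | clear | finish | ask | final
  deriving Fintype

/-- Words to be put on top of stacks, and the next label. -/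
abbrev Act (r : ℕ) := List (Stk × List Sym) × Lab r

/-- The counter that is copied. -/
def NameKind.counter : NameKind → Stk
  | vertex => .pos
  | fresh => .base
  | pin => .base

section

variable {r : ℕ} (mask p : ℕ → Bool)

/-- Proceed to naming the arguments at the positions below `k`, in decreasing order. -/
def nextName : (k : ℕ) → k ≤ r → Act r
  | 0, _ => ([(.out, [.bit false])], .skip)
  | k + 1, h =>
    if mask k then ([(.out, [.bit false])], .scan ⟨k, h⟩)
    else ([(.out, ones k ++ [.bit false])], .copy .fresh ⟨k, h⟩)

/-- Proceed to the pins of the last `r` variables whose index is below `k`, in decreasing order. -/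
def nextPin : (k : ℕ) → k ≤ r → Act r
  | 0, _ => ([(.base, ones r)], .row)
  | k + 1, h => ([(.out, ones k ++ [.bit false, .bar])], .copy .pin ⟨k, h⟩)

/-- The stack of which a label pops the top symbol, and what follows on it. -/
def trans : Lab r → Stk × (Option Sym → Act r)
  | .init => (.io, fun x =>
      if x = some (.bit true) then ([(.base, [.bit true])], .init) else ([], .row))
  | .row => (.io, fun x =>
      match x with
      | none => ([(.out, [.bar])], .finish)
      | some s => ((.io, [s]) :: (.out, [.bar]) :: (nextName mask r le_rfl).1,
          (nextName mask r le_rfl).2))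
  | .scan i => (.io, fun x =>
      match x with
      | some (.bit true) => ([], .copy .vertex i)
      | some (.bit false) => ([(.pos, [.bit true])], .scan i)
      | _ => ([(.io, [.bar]), (.out, ones i)], .copy .fresh i))
  | .copy m i => (m.counter, fun x =>
      match x with
      | some s => ([(.aux, [s]), (.out, [s])], .copy m i)
      | none => ([], .restore m i))
  | .restore m i => (.aux, fun x =>
      match x with
      | some s => ([(m.counter, [s])], .restore m i)
      | none =>
        match m with
        | .vertex => ((.pos, [.bit true]) :: (nextName mask i i.2.le).1, (nextName mask i i.2.le).2)
        | .fresh => nextName mask i i.2.le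
        | .pin => ((.out, ones (pinName (p i)) ++ [.bit false]) :: (nextPin i i.2.le).1,
            (nextPin i i.2.le).2))
  | .skip => (.io, fun x => ([], if x = some .bar then .clear else .skip))
  | .clear => (.pos, fun x => if x = none then nextPin r le_rfl else ([], .clear))
  | .finish => (.base, fun x =>
      match x with
      | some s => ([(.out, [s])], .finish)
      | none => ([], .ask))
  | .ask => (.io, fun _ => ([], .final))
  | .final => (.io, fun _ => ([], .final))

/-- Push a word. -/
def pushWord (k : Stk) : List Sym → Turing.TM2.Stmt (fun _ : Stk => Sym) (Lab r) (Option Sym) →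
    Turing.TM2.Stmt (fun _ : Stk => Sym) (Lab r) (Option Sym)
  | [], q => q
  | s :: w, q => pushWord k w (.push k (fun _ => s) q)

/-- The statement that carries out an action. -/
def actStmt (l : Lab r) : List (Stk × List Sym) →
    Turing.TM2.Stmt (fun _ : Stk => Sym) (Lab r) (Option Sym)
  | [] => .load (fun _ => none) (.goto fun _ => l)
  | a :: as => pushWord a.1 a.2 (actStmt l as)

/-- The statement that pops a symbol and acts accordingly. -/
def popStmt (k : Stk) (f : Option Sym → Act r) :
    Turing.TM2.Stmt (fun _ : Stk => Sym) (Lab r) (Option Sym) :=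
  .pop k (fun _ x => x) <|
    .branch (fun x => x = none) (actStmt (f none).2 (f none).1) <|
    .branch (fun x => x = some .bar) (actStmt (f (some .bar)).2 (f (some .bar)).1) <|
    .branch (fun x => x = some (.bit true))
      (actStmt (f (some (.bit true))).2 (f (some (.bit true))).1)
      (actStmt (f (some (.bit false))).2 (f (some (.bit false))).1)

/-- The machine that reduces `#w-HIS_d`. -/
def reduction (r : ℕ) (mask p : ℕ → Bool) : OracleTM where
  K := Stk
  Λ := Lab r
  σ := Option Sym
  main := .init
  init := none
  prog
    | .ask => .query .final
    | .final => .det .halt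
    | l => .det (popStmt (trans mask p l).1 (trans mask p l).2)
  inputStk := .io
  errorStk := .err
  queryStk := .out
  queryErrorStk := .err
  answerStk := .io
  outputStk := .io

/-- The contents of the stacks after some words have been put on top of them. -/
def applyAct (S : Stk → List Sym) : List (Stk × List Sym) → Stk → List Sym
  | [] => S
  | a :: as => applyAct (Function.update S a.1 (a.2 ++ S a.1)) as

/-! ### Effect of the machine's statements on the stacks -/

theorem stepAux_pushWord (k : Stk) (w : List Sym) (q) (v : Option Sym) (S : Stk → List Sym) :
    Turing.TM2.stepAux (pushWord (r := r) k w q) v S =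
      Turing.TM2.stepAux q v (Function.update S k (w ++ S k)) := by
  induction w generalizing q with
  | nil => simp [pushWord]
  | cons s w ih => simp [pushWord, ih, Turing.TM2.stepAux]

theorem stepAux_actStmt (l : Lab r) (as : List (Stk × List Sym)) (v : Option Sym)
    (S : Stk → List Sym) :
    Turing.TM2.stepAux (actStmt l as) v S = ⟨some l, none, applyAct S as⟩ := by
  induction as generalizing S with
  | nil => rfl
  | cons a as ih => rw [actStmt, stepAux_pushWord, ih, applyAct]

/-- The three branches distinguish all four values of the popped symbol. Every action ends by
clearing the internal memory, so the old memory `v` leaves no trace. -/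
theorem stepAux_popStmt (k : Stk) (f : Option Sym → Act r) (v : Option Sym)
    (S : Stk → List Sym) :
    Turing.TM2.stepAux (popStmt k f) v S =
      ⟨some (f (S k).head?).2, none,
        applyAct (Function.update S k (S k).tail) (f (S k).head?).1⟩ := by
  rcases h : (S k).head? with _ | (_ | _) | _ <;>
    simp [popStmt, Turing.TM2.stepAux, h, stepAux_actStmt]

/-- Stacks with the given contents. -/
def store (io err base pos aux out : List Sym) : Stk → List Sym
  | .io => io
  | .err => err
  | .base => base
  | .pos => pos
  | .aux => aux
  | .out => out

variable (io err base pos aux out x : List Sym)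

@[simp] theorem update_store_io : Function.update (store io err base pos aux out) .io x =
    store x err base pos aux out := by funext k; cases k <;> rfl
@[simp] theorem update_store_base : Function.update (store io err base pos aux out) .base x =
    store io err x pos aux out := by funext k; cases k <;> rfl
@[simp] theorem update_store_pos : Function.update (store io err base pos aux out) .pos x =
    store io err base x aux out := by funext k; cases k <;> rfl
@[simp] theorem update_store_aux : Function.update (store io err base pos aux out) .aux x =
    store io err base pos x out := by funext k; cases k <;> rfl
@[simp] theorem update_store_out : Function.update (store io err base pos aux out) .out x =
    store io err base pos aux x := by funext k; cases k <;> rfl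

/-- A configuration with empty internal memory. -/
def cfg (r : ℕ) (mask p : ℕ → Bool) (l : Lab r) (S : Stk → List Sym) : (reduction r mask p).Cfg :=
  ⟨some l, none, S⟩

theorem reach_step (l : Lab r) (h₁ : l ≠ .ask) (h₂ : l ≠ .final) (S : Stk → List Sym) :
    (reduction r mask p).ReachLE 1 (cfg r mask p l S)
      (cfg r mask p ((trans mask p l).2 (S (trans mask p l).1).head?).2
        (applyAct (Function.update S (trans mask p l).1 (S (trans mask p l).1).tail)
          ((trans mask p l).2 (S (trans mask p l).1).head?).1)) := by
  refine ⟨1, le_rfl, .step l (popStmt (trans mask p l).1 (trans mask p l).2) rfl ?_ ?_⟩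
  · cases l <;> first | rfl | exact absurd rfl h₁ | exact absurd rfl h₂
  · exact (stepAux_popStmt _ _ _ _) ▸ .refl _

end

/-! ### Runs of the machine and their duration -/

open OracleTM

section

variable {r : ℕ} {mask p : ℕ → Bool}

/-- The configuration after an action. -/
def enter (r : ℕ) (mask p : ℕ → Bool) (a : Act r) (S : Stk → List Sym) :
    (reduction r mask p).Cfg :=
  cfg r mask p a.2 (applyAct S a.1)

/-- Peels one transition off a run. The labels `ask` and `final` are excluded because there the
program does not follow `trans`. -/
theorem reach_cons {l : Lab r} {S : Stk → List Sym} {B : ℕ} {c : (reduction r mask p).Cfg}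
    (h₁ : l ≠ .ask) (h₂ : l ≠ .final)
    (h : (reduction r mask p).ReachLE B
      (enter r mask p ((trans mask p l).2 (S (trans mask p l).1).head?)
        (Function.update S (trans mask p l).1 (S (trans mask p l).1).tail)) c) :
    (reduction r mask p).ReachLE (B + 1) (cfg r mask p l S) c := by
  rw [Nat.add_comm]
  exact (reach_step mask p l h₁ h₂ S).trans h

theorem ones_succ (n : ℕ) : ones (n + 1) = .bit true :: ones n := rfl

theorem ones_append_cons (n : ℕ) (l : List Sym) :
    ones n ++ .bit true :: l = .bit true :: (ones n ++ l) := by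
  induction n with
  | zero => rfl
  | succ n ih => rw [ones_succ, List.cons_append, ih]; rfl

theorem ones_append_ones (a b : ℕ) : ones a ++ ones b = ones (a + b) :=
  List.replicate_append_replicate ..

theorem reach_copy_vertex (i : Fin r) (n : ℕ) (io err base aux out : List Sym) :
    (reduction r mask p).ReachLE (n + 1)
      (cfg r mask p (.copy .vertex i) (store io err base (ones n) aux out))
      (cfg r mask p (.restore .vertex i) (store io err base [] (ones n ++ aux) (ones n ++ out))) := by
  induction n generalizing aux out with
  | zero => exact reach_cons nofun nofun (by
      simpa [enter, trans, applyAct, NameKind.counter, store, ones] using ReachLE.refl _)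
  | succ n ih =>
    refine reach_cons nofun nofun ?_
    have := ih (.bit true :: aux) (.bit true :: out)
    simpa [enter, trans, applyAct, NameKind.counter, store, ones_succ, ones_append_cons] using this

theorem reach_copy_base {m : NameKind} (hm : m ≠ .vertex) (i : Fin r) (n : ℕ)
    (io err pos aux out : List Sym) :
    (reduction r mask p).ReachLE (n + 1)
      (cfg r mask p (.copy m i) (store io err (ones n) pos aux out))
      (cfg r mask p (.restore m i) (store io err [] pos (ones n ++ aux) (ones n ++ out))) := by
  have hc : m.counter = .base := by cases m <;> first | rfl | exact absurd rfl hm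
  induction n generalizing aux out with
  | zero => exact reach_cons nofun nofun (by
      simpa [enter, trans, applyAct, hc, store, ones] using ReachLE.refl _)
  | succ n ih =>
    refine reach_cons nofun nofun ?_
    have := ih (.bit true :: aux) (.bit true :: out)
    simpa [enter, trans, applyAct, hc, store, ones_succ, ones_append_cons] using this

/-- The counter comes back one larger than it was copied, because the bit that announced the vertex
has already been popped from the row. -/
theorem reach_restore_vertex (i : Fin r) (n : ℕ) (io err base pos out : List Sym) :
    (reduction r mask p).ReachLE (n + 1)
      (cfg r mask p (.restore .vertex i) (store io err base pos (ones n) out))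
      (enter r mask p (nextName mask i i.2.le)
        (store io err base (ones (n + 1) ++ pos) [] out)) := by
  induction n generalizing pos with
  | zero => exact reach_cons nofun nofun (by
      simpa [enter, trans, applyAct, store, ones] using ReachLE.refl _)
  | succ n ih =>
    refine reach_cons nofun nofun ?_
    have := ih (.bit true :: pos)
    simpa [enter, trans, applyAct, NameKind.counter, store, ones_succ, ones_append_cons] using this

theorem reach_restore_base {m : NameKind} (hm : m ≠ .vertex) (i : Fin r) (n : ℕ)
    (io err base pos out : List Sym) :
    (reduction r mask p).ReachLE (n + 1)
      (cfg r mask p (.restore m i) (store io err base pos (ones n) out))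
      (enter r mask p ((trans mask p (.restore m i)).2 none)
        (store io err (ones n ++ base) pos [] out)) := by
  have hc : m.counter = .base := by cases m <;> first | rfl | exact absurd rfl hm
  induction n generalizing base with
  | zero => exact reach_cons nofun nofun (by
      simpa [enter, trans, applyAct, store, ones] using ReachLE.refl _)
  | succ n ih =>
    refine reach_cons nofun nofun ?_
    have := ih (.bit true :: base)
    simpa [enter, trans, applyAct, hc, store, ones_succ, ones_append_cons] using this

theorem reach_vertex (i : Fin r) (n : ℕ) (io err base out : List Sym) :
    (reduction r mask p).ReachLE (2 * n + 2)
      (cfg r mask p (.copy .vertex i) (store io err base (ones n) [] out))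
      (enter r mask p (nextName mask i i.2.le)
        (store io err base (ones (n + 1)) [] (ones n ++ out))) := by
  have h₁ := reach_copy_vertex (mask := mask) (p := p) i n io err base [] out
  have h₂ := reach_restore_vertex (mask := mask) (p := p) i n io err base [] (ones n ++ out)
  simp only [List.append_nil] at h₁ h₂
  exact (h₁.trans h₂).mono (by omega)

theorem reach_base {m : NameKind} (hm : m ≠ .vertex) (i : Fin r) (n : ℕ)
    (io err pos out : List Sym) :
    (reduction r mask p).ReachLE (2 * n + 2)
      (cfg r mask p (.copy m i) (store io err (ones n) pos [] out))
      (enter r mask p ((trans mask p (.restore m i)).2 none)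
        (store io err (ones n) pos [] (ones n ++ out))) := by
  have h₁ := reach_copy_base (mask := mask) (p := p) hm i n io err pos [] out
  have h₂ := reach_restore_base (mask := mask) (p := p) hm i n io err [] pos (ones n ++ out)
  simp only [List.append_nil] at h₁ h₂
  exact (h₁.trans h₂).mono (by omega)

/-- The remainder of a row of an incidence matrix on the input stack. -/
def rowCode (bs : List Bool) : List Sym := bs.map Sym.bit ++ [Sym.bar]

/-- Scanning a row up to the next one. -/
theorem reach_scan (i : Fin r) (bs : List Bool) (g : ℕ) (rest err base out : List Sym) :
    (truePositions bs g = [] ∧ (reduction r mask p).ReachLE (bs.length + 1)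
      (cfg r mask p (.scan i) (store (rowCode bs ++ rest) err base (ones g) [] out))
      (cfg r mask p (.copy .fresh i) (store (rowCode [] ++ rest) err base
        (ones (g + bs.length)) [] (ones i ++ out)))) ∨
    ∃ v bs' k, truePositions bs g = v :: truePositions bs' (v + 1) ∧ g + k = v + 1 ∧
      bs'.length + k = bs.length ∧ (reduction r mask p).ReachLE k
        (cfg r mask p (.scan i) (store (rowCode bs ++ rest) err base (ones g) [] out))
        (cfg r mask p (.copy .vertex i) (store (rowCode bs' ++ rest) err base (ones v) [] out)) := by
  induction bs generalizing g with
  | nil =>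
    refine .inl ⟨rfl, reach_cons nofun nofun ?_⟩
    simpa [enter, trans, applyAct, store, rowCode] using ReachLE.refl _
  | cons x bs ih =>
    cases x with
    | true =>
      refine .inr ⟨g, bs, 1, rfl, rfl, rfl, reach_cons (B := 0) nofun nofun ?_⟩
      simpa [enter, trans, applyAct, store, rowCode] using ReachLE.refl _
    | false =>
      rcases ih (g + 1) with ⟨h, hr⟩ | ⟨v, bs', k, h₁, h₂, h₃, hr⟩
      · refine .inl ⟨h, reach_cons (B := bs.length + 1) nofun nofun ?_⟩
        rw [List.length_cons, show g + (bs.length + 1) = g + 1 + bs.length by omega]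
        simpa [enter, trans, applyAct, store, rowCode, ones_succ] using hr
      · refine .inr ⟨v, bs', k + 1, h₁, by omega, by rw [List.length_cons]; omega,
          reach_cons (B := k) nofun nofun ?_⟩
        simpa [enter, trans, applyAct, store, rowCode, ones_succ] using hr

/-- Naming the arguments at the positions below `k`. -/
theorem reach_nextName (k : ℕ) (hk : k ≤ r) (bs : List Bool) (g b : ℕ)
    (rest err out : List Sym) {N : ℕ} (hN : g + bs.length ≤ N) (hb : b ≤ N) :
    ∃ bs' g', g' + bs'.length ≤ N ∧ (reduction r mask p).ReachLE (k * (3 * N + 3))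
      (enter r mask p (nextName mask k hk)
        (store (rowCode bs ++ rest) err (ones b) (ones g) [] out))
      (cfg r mask p .skip (store (rowCode bs' ++ rest) err (ones b) (ones g') []
        (.bit false :: ((scopeNames mask b k (truePositions bs g)).flatMap natCode ++ out)))) := by
  induction k generalizing bs g out with
  | zero =>
    refine ⟨bs, g, hN, ?_⟩
    rw [Nat.zero_mul]
    simpa [enter, nextName, applyAct, store, scopeNames] using ReachLE.refl _
  | succ k ih =>
    -- A new variable is named in two situations: at an unmasked position, and at a masked one once
    -- the row has no further ones.
    have hfresh (bs : List Bool) (g : ℕ) (hN : g + bs.length ≤ N) : ∃ bs' g', g' + bs'.length ≤ N ∧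
        (reduction r mask p).ReachLE ((2 * b + 2) + k * (3 * N + 3))
        (cfg r mask p (.copy .fresh ⟨k, hk⟩) (store (rowCode bs ++ rest) err (ones b) (ones g) []
          (ones k ++ .bit false :: out)))
        (cfg r mask p .skip (store (rowCode bs' ++ rest) err (ones b) (ones g') []
          (.bit false :: ((scopeNames mask b k (truePositions bs g)).flatMap natCode ++
            (natCode (b + k) ++ out))))) := by
      obtain ⟨bs', g', h, hr⟩ := ih (Nat.le_of_lt hk) bs g (natCode (b + k) ++ out) hN
      refine ⟨bs', g', h, (reach_base (m := .fresh) nofun _ _ _ _ _ _).trans ?_⟩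
      simpa [trans, natCode, ← ones_append_ones] using hr
    cases hm : mask k with
    | false =>
      obtain ⟨bs', g', h, hr⟩ := hfresh bs g hN
      refine ⟨bs', g', h, ReachLE.mono (B := (2 * b + 2) + k * (3 * N + 3)) ?_ (by lia)⟩
      simpa [enter, nextName, hm, applyAct, store, scopeNames] using hr
    | true =>
      rcases reach_scan (mask := mask) (p := p) ⟨k, hk⟩ bs g rest err (ones b)
        (.bit false :: out) with ⟨h₀, hs⟩ | ⟨v, bs₁, j, h₀, h₁, h₂, hs⟩
      · obtain ⟨bs', g', h, hr⟩ := hfresh [] (g + bs.length) hN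
        refine ⟨bs', g', h, ReachLE.mono (B := bs.length + 1 + ((2 * b + 2) + k * (3 * N + 3))) ?_
          (by lia)⟩
        have := hs.trans hr
        simpa [enter, nextName, hm, applyAct, store, scopeNames, h₀, truePositions] using this
      · obtain ⟨bs', g', h, hr⟩ := ih (Nat.le_of_lt hk) bs₁ (v + 1) (natCode v ++ out) (by omega)
        refine ⟨bs', g', h, ReachLE.mono (B := j + ((2 * v + 2) + k * (3 * N + 3))) ?_ (by lia)⟩
        have := hs.trans ((reach_vertex (mask := mask) (p := p) ⟨k, hk⟩ v (rowCode bs₁ ++ rest) err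
          (ones b) (.bit false :: out)).trans (by simpa [natCode] using hr))
        simpa [enter, nextName, hm, applyAct, store, scopeNames, h₀, natCode] using this

/-- Pinning the last `r` variables with index below `k`. -/
theorem reach_nextPin (k : ℕ) (hk : k ≤ r) (b : ℕ) (io err out : List Sym) :
    (reduction r mask p).ReachLE (k * (2 * b + 2))
      (enter r mask p (nextPin k hk) (store io err (ones b) [] [] out))
      (cfg r mask p .row (store io err (ones (b + r)) [] [] (pinsCode p b k ++ out))) := by
  induction k generalizing out with
  | zero =>
    rw [Nat.zero_mul]
    simpa [enter, nextPin, applyAct, store, pinsCode, ones_append_ones, Nat.add_comm] using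
      ReachLE.refl _
  | succ k ih =>
    have := ih (Nat.le_of_lt hk) (rawCode (pinName (p k)) [b + k] ++ out)
    refine ReachLE.mono (B := (2 * b + 2) + k * (2 * b + 2)) ?_ (by lia)
    have := (reach_base (mask := mask) (p := p) (m := .pin) nofun ⟨k, hk⟩ b io err []
      (ones k ++ .bit false :: .bar :: out)).trans (B' := k * (2 * b + 2))
      (by simpa [enter, trans, applyAct, store, rawCode, natCode, ← ones_append_ones] using this)
    simpa [enter, nextPin, applyAct, store, pinsCode, List.range_succ, rawCode, natCode,
      ← ones_append_ones] using this

theorem reach_skip (bs : List Bool) (rest err base pos out : List Sym) :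
    (reduction r mask p).ReachLE (bs.length + 1)
      (cfg r mask p .skip (store (rowCode bs ++ rest) err base pos [] out))
      (cfg r mask p .clear (store rest err base pos [] out)) := by
  induction bs with
  | nil =>
    refine reach_cons nofun nofun ?_
    simpa [enter, trans, applyAct, store, rowCode] using ReachLE.refl _
  | cons x bs ih =>
    refine reach_cons (B := bs.length + 1) nofun nofun ?_
    simpa [enter, trans, applyAct, store, rowCode] using ih

theorem reach_clear (n : ℕ) (io err base out : List Sym) :
    (reduction r mask p).ReachLE (n + 1)
      (cfg r mask p .clear (store io err base (ones n) [] out))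
      (enter r mask p (nextPin r le_rfl) (store io err base [] [] out)) := by
  induction n with
  | zero =>
    refine reach_cons nofun nofun ?_
    simpa [enter, trans, applyAct, store, ones] using ReachLE.refl _
  | succ n ih =>
    refine reach_cons nofun nofun ?_
    simpa [enter, trans, applyAct, store, ones_succ] using ih

theorem reach_row (bs : List Bool) (b : ℕ) (rest err out : List Sym) {N : ℕ}
    (hN : bs.length ≤ N) (hb : b ≤ N) :
    (reduction r mask p).ReachLE ((r + 1) * (5 * N + 6))
      (cfg r mask p .row (store (rowCode bs ++ rest) err (ones b) [] [] out))
      (cfg r mask p .row (store rest err (ones (b + r)) [] [] (pinsCode p b r ++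
        (rawCode 0 (scopeNames mask b r (truePositions bs 0)) ++ out)))) := by
  obtain ⟨bs', g, hg, h₁⟩ := reach_nextName (mask := mask) (p := p) r le_rfl bs 0 b rest err
    (.bar :: out) (by simpa using hN) hb
  have h₂ := ((h₁.trans (reach_skip bs' rest err (ones b) (ones g) _)).trans
    (reach_clear g rest err (ones b) _)).trans (reach_nextPin r le_rfl b rest err _)
  refine ReachLE.mono (reach_cons (B := r * (3 * N + 3) + (bs'.length + 1) + (g + 1) +
    r * (2 * b + 2)) nofun nofun ?_) ?_
  -- Even an empty row has its closing separator, so `row` finds a symbol, puts it back and starts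
  -- naming.
  · obtain ⟨s, l, hs⟩ : ∃ s l, rowCode bs ++ rest = s :: l := by
      cases bs <;> exact ⟨_, _, rfl⟩
    rw [hs] at h₂ ⊢
    simpa [enter, trans, applyAct, store, rawCode, ones] using h₂
  · have : r * b ≤ r * N := Nat.mul_le_mul_left r hb
    lia

theorem reach_rows (E : List (List Bool)) (b : ℕ) (err out : List Sym) {N : ℕ}
    (hE : ∀ bs ∈ E, bs.length ≤ N) (hb : b + r * E.length ≤ N) :
    (reduction r mask p).ReachLE (E.length * ((r + 1) * (5 * N + 6)) + 1)
      (cfg r mask p .row (store (E.flatMap rowCode) err (ones b) [] [] out))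
      (cfg r mask p .finish (store [] err (ones (b + r * E.length)) [] []
        (.bar :: (rowsCode r mask p E b ++ out)))) := by
  induction E generalizing b out with
  | nil =>
    refine reach_cons nofun nofun ?_
    simpa [enter, trans, applyAct, store, rowsCode] using ReachLE.refl _
  | cons bs E ih =>
    rw [List.length_cons, Nat.mul_succ] at hb
    have h₁ := reach_row (r := r) (mask := mask) (p := p) bs b (E.flatMap rowCode) err out (N := N)
      (hE bs List.mem_cons_self) (by omega)
    have h₂ := h₁.trans (ih (b + r) _ (fun c hc => hE c (List.mem_cons_of_mem _ hc)) (by omega))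
    refine ReachLE.mono (B := (r + 1) * (5 * N + 6) + (E.length * ((r + 1) * (5 * N + 6)) + 1)) ?_
      (by rw [List.length_cons]; lia)
    have e : b + r * (E.length + 1) = b + r + r * E.length := by lia
    simpa [rowsCode, e] using h₂

theorem reach_finish (n : ℕ) (io err pos out : List Sym) :
    (reduction r mask p).ReachLE (n + 1)
      (cfg r mask p .finish (store io err (ones n) pos [] out))
      (cfg r mask p .ask (store io err [] pos [] (ones n ++ out))) := by
  induction n generalizing out with
  | zero =>
    refine reach_cons nofun nofun ?_
    simpa [enter, trans, applyAct, store, ones] using ReachLE.refl _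
  | succ n ih =>
    refine reach_cons nofun nofun ?_
    simpa [enter, trans, applyAct, store, ones_succ, ones_append_cons] using ih (.bit true :: out)

theorem reach_init (n b : ℕ) (io err out : List Sym) :
    (reduction r mask p).ReachLE (n + 1)
      (cfg r mask p .init (store (ones n ++ .bar :: io) err (ones b) [] [] out))
      (cfg r mask p .row (store io err (ones (b + n)) [] [] out)) := by
  induction n generalizing b with
  | zero =>
    refine reach_cons nofun nofun ?_
    simpa [enter, trans, applyAct, store, ones] using ReachLE.refl _
  | succ n ih =>
    refine reach_cons nofun nofun ?_
    rw [show b + (n + 1) = b + 1 + n by omega]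
    simpa [enter, trans, applyAct, store, ones_succ] using ih (b + 1)

theorem start_eq (x e : List Sym) : (reduction r mask p).start x e =
    cfg r mask p .init (store x e [] [] [] []) := by
  simp only [OracleTM.start, cfg]
  congr 1
  funext k
  cases k <;> rfl

/-- The computation of the machine up to the oracle call. -/
theorem reach_ask (n : ℕ) (E : List (List Bool)) (hE : ∀ bs ∈ E, bs.length = n) (e : List Sym) :
    (reduction r mask p).ReachLE
      (40 * (r + 1) ^ 2 * (ones n ++ .bar :: E.flatMap rowCode).length ^ 2)
      ((reduction r mask p).start (ones n ++ .bar :: E.flatMap rowCode) e)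
      (cfg r mask p .ask (store [] e [] [] []
        (ones (n + r * E.length) ++ .bar :: rowsCode r mask p E n))) := by
  have h := ((reach_init (mask := mask) (p := p) (r := r) n 0 (E.flatMap rowCode) e []).trans
    -- This `N` is the final number of variables; it bounds both counters throughout.
    (reach_rows E (0 + n) e [] (N := n + r * E.length)
      (fun bs hbs => by rw [hE bs hbs]; omega) (by omega))).trans
    (reach_finish (0 + n + r * E.length) [] e [] _)
  rw [start_eq]
  refine ReachLE.mono (by simpa [ones] using h) ?_
  have hlen : (E.flatMap rowCode).length = E.length * (n + 1) := by
    clear h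
    induction E with
    | nil => simp
    | cons bs E ih =>
      rw [List.flatMap_cons, List.length_append,
        ih fun c hc => hE c (List.mem_cons_of_mem _ hc)]
      simp [rowCode, hE bs List.mem_cons_self]
      ring
  simp only [List.length_append, List.length_cons, hlen, ones, List.length_replicate]
  generalize E.length = m
  -- `X` is the length of the input. It bounds `n` and the number `m` of rows, so `m` rows at a cost
  -- linear in `n + r * m` stay quadratic in `X`.
  set X := n + (m * (n + 1) + 1) with hX
  have h₁ : n ≤ X := by lia
  have h₂ : m ≤ X := by nlinarith
  have h₃ : 1 ≤ X := by lia
  have h₄ : n + r * m ≤ (r + 1) * X := by nlinarith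
  have h₅ : (r + 1) * (5 * (n + r * m) + 6) ≤ (r + 1) * (11 * ((r + 1) * X)) :=
    Nat.mul_le_mul_left _ (by nlinarith)
  have h₆ := Nat.mul_le_mul h₂ h₅
  have h₇ : (r + 1) * X ≤ (r + 1) ^ 2 * X ^ 2 := by
    rw [← mul_pow]; exact Nat.le_self_pow two_ne_zero _
  have h₈ : X ≤ (r + 1) * X := Nat.le_mul_of_pos_left _ (by omega)
  have h₉ : X * ((r + 1) * (11 * ((r + 1) * X))) = 11 * ((r + 1) ^ 2 * X ^ 2) := by ring
  rw [Nat.mul_assoc]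
  lia

end

/-! ## Instances with natural numbers as variables -/

section

variable {Γ : Language}

/-- A constraint on natural numbers below `N` as a constraint on `Fin N`. -/
def Constraint.toFin (N : ℕ) (c : Constraint Γ ℕ) (h : ∀ i, c.scope i < N) :
    Constraint Γ (Fin N) :=
  ⟨c.name, fun i => ⟨c.scope i, h i⟩⟩

/-- The code of a constraint on natural numbers. -/
def Constraint.natCode (c : Constraint Γ ℕ) : List Sym :=
  rawCode c.name.val (List.ofFn c.scope)

theorem Constraint.code_toFin (N : ℕ) (c : Constraint Γ ℕ) (h : ∀ i, c.scope i < N) :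
    (c.toFin N h).code = c.natCode := by
  have : (List.ofFn (c.toFin N h).scope).flatMap varCode =
      (List.ofFn c.scope).flatMap BoundedCSP.natCode := by
    simp only [List.flatMap, List.map_ofFn]
    rfl
  rw [code, natCode, rawCode, ← this]
  rfl

theorem Constraint.toFin_injective (N : ℕ) (c c' : Constraint Γ ℕ) (h : ∀ i, c.scope i < N)
    (h' : ∀ i, c'.scope i < N) (e : c.toFin N h = c'.toFin N h') : c = c' := by
  obtain ⟨a, s⟩ := c
  obtain ⟨a', s'⟩ := c'
  simp only [toFin, Constraint.mk.injEq] at e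
  obtain ⟨rfl, e⟩ := e
  congr
  funext i
  exact congrArg Fin.val (congrFun (eq_of_heq e) i)

/-- An assignment to `Fin N`, extended by zero. -/
def extend {N : ℕ} (τ : Fin N → Bool) (v : ℕ) : Bool := if h : v < N then τ ⟨v, h⟩ else false

/-- The instance with the given constraints on the variables below `N`. -/
def CSPInstance.ofNat {d : ℕ} (N : ℕ) (L : List (Constraint Γ ℕ))
    (hL : ∀ c ∈ L, ∀ i, c.scope i < N) (hnd : L.Nodup)
    (hd : ∀ v, (L.map fun c => c.occ v).sum ≤ d) : CSPInstance d Γ where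
  n := N
  constraints := L.pmap (Constraint.toFin N) hL
  nodup := hnd.pmap fun c h c' h' => Constraint.toFin_injective N c c' h h'
  degree_le v := by
    refine le_trans (le_of_eq ?_) (hd v)
    rw [List.map_pmap, ← List.pmap_eq_map (H := hL)]
    congr 2
    funext c h
    simp only [Constraint.occ, Constraint.toFin, Fin.ext_iff]
    rfl

variable {d N : ℕ} {L : List (Constraint Γ ℕ)} {hL : ∀ c ∈ L, ∀ i, c.scope i < N} {hnd : L.Nodup}
    {hd : ∀ v, (L.map fun c => c.occ v).sum ≤ d}

theorem CSPInstance.code_ofNat : (CSPInstance.ofNat N L hL hnd hd).code =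
    ones N ++ .bar :: L.flatMap Constraint.natCode := by
  simp only [CSPInstance.code, CSPInstance.ofNat, List.flatMap]
  rw [List.map_pmap, ← List.pmap_eq_map (H := hL)]
  congr 4
  funext c h
  exact Constraint.code_toFin N c h

theorem CSPInstance.Z_ofNat : (CSPInstance.ofNat N L hL hnd hd).Z =
    Set.ncard {τ : Fin N → Bool | ∀ c ∈ L, c.Satisfied (extend τ)} := by
  have : ∀ τ : Fin N → Bool, (∀ c ∈ L.pmap (Constraint.toFin N) hL, c.Satisfied τ) ↔
      ∀ c ∈ L, c.Satisfied (extend τ) := by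
    intro τ
    have hc (c : Constraint Γ ℕ) (h : ∀ i, c.scope i < N) :
        (c.toFin N h).Satisfied τ ↔ c.Satisfied (extend τ) := by
      have : (fun i => extend τ (c.scope i)) = fun i => τ ((c.toFin N h).scope i) :=
        funext fun i => dif_pos (h i)
      rw [Constraint.Satisfied, Constraint.Satisfied, this]
      rfl
    constructor
    · intro h c hcL
      exact (hc c (hL c hcL)).1 (h _ (List.mem_pmap.2 ⟨c, hcL, rfl⟩))
    · intro h c' hc'
      obtain ⟨c, hcL, rfl⟩ := List.mem_pmap.1 hc'
      exact (hc c (hL c hcL)).2 (h c hcL)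
  exact congrArg Set.ncard (Set.ext this)

end

/-! ## Names of variables -/

theorem mem_truePositions {bs : List Bool} {g v : ℕ} :
    v ∈ truePositions bs g ↔ ∃ i, v = g + i ∧ bs[i]? = some true := by
  induction bs generalizing g with
  | nil => simp [truePositions]
  | cons x bs ih =>
    have key : (∃ i, v = g + i ∧ (x :: bs)[i]? = some true) ↔
        (v = g ∧ x = true) ∨ ∃ i, v = g + 1 + i ∧ bs[i]? = some true := by
      constructor
      · rintro ⟨_ | i, h, h'⟩
        · exact .inl ⟨h, by simpa using h'⟩
        · exact .inr ⟨i, by omega, by simpa using h'⟩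
      · rintro (⟨h, h'⟩ | ⟨i, h, h'⟩)
        · exact ⟨0, h, by simpa using h'⟩
        · exact ⟨i + 1, by omega, by simpa using h'⟩
    rw [key, ← ih]
    cases x <;> simp [truePositions]

theorem truePositions_nodup (bs : List Bool) (g : ℕ) : (truePositions bs g).Nodup := by
  induction bs generalizing g with
  | nil => simp [truePositions]
  | cons x bs ih =>
    cases x with
    | false => exact ih _
    | true =>
      refine List.nodup_cons.2 ⟨fun h => ?_, ih _⟩
      obtain ⟨i, h, -⟩ := mem_truePositions.1 h
      omega

theorem lt_of_mem_truePositions {bs : List Bool} {v : ℕ} (h : v ∈ truePositions bs 0) :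
    v < bs.length := by
  obtain ⟨i, rfl, h'⟩ := mem_truePositions.1 h
  simpa using (List.getElem?_eq_some_iff.1 h').1

theorem truePositions_injective {bs bs' : List Bool} (hl : bs.length = bs'.length)
    (h : ∀ v, v ∈ truePositions bs 0 ↔ v ∈ truePositions bs' 0) : bs = bs' := by
  refine List.ext_getElem hl fun i h₁ h₂ => ?_
  have := h i
  simp only [mem_truePositions, Nat.zero_add, exists_eq_left', List.getElem?_eq_getElem h₁,
    List.getElem?_eq_getElem h₂, Option.some.injEq] at this
  exact Bool.eq_iff_iff.2 this

section

variable {mask : ℕ → Bool} {b : ℕ}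

/-- One step of the recursion. -/
theorem scopeNames_succ (k : ℕ) (vs : List ℕ) :
    (scopeNames mask b (k + 1) vs = scopeNames mask b k vs ++ [b + k] ∧
      (mask k = true → vs = [])) ∨
    ∃ v vs', vs = v :: vs' ∧ mask k = true ∧
      scopeNames mask b (k + 1) vs = scopeNames mask b k vs' ++ [v] := by
  cases hm : mask k <;> cases vs <;> simp [scopeNames, hm]

theorem length_scopeNames (k : ℕ) (vs : List ℕ) : (scopeNames mask b k vs).length = k := by
  induction k generalizing vs with
  | zero => rfl
  | succ k ih => rcases scopeNames_succ k vs with ⟨h, -⟩ | ⟨v, vs', -, -, h⟩ <;>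
      rw [h, List.length_append, ih, List.length_singleton]

theorem scopeNames_getD (k : ℕ) (vs : List ℕ) (i : ℕ) (hi : i < k) :
    (scopeNames mask b k vs).getD i 0 = b + i ∨
      (mask i = true ∧ (scopeNames mask b k vs).getD i 0 ∈ vs) := by
  induction k generalizing vs with
  | zero => omega
  | succ k ih =>
    rcases Nat.lt_succ_iff_lt_or_eq.1 hi with hi | rfl
    · rcases scopeNames_succ k vs with ⟨h, -⟩ | ⟨v, vs', rfl, -, h⟩ <;>
        rw [h, List.getD_append _ _ _ _ (by rwa [length_scopeNames])]
      · exact ih vs hi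
      · exact (ih vs' hi).imp_right fun h => ⟨h.1, List.mem_cons_of_mem _ h.2⟩
    · rcases scopeNames_succ i vs with ⟨h, -⟩ | ⟨v, vs', rfl, hm, h⟩ <;>
        rw [h, List.getD_append_right _ _ _ _ (by rw [length_scopeNames])] <;>
        simp [length_scopeNames, *]

/-- No vertex is lost: a masked position takes a vertex whenever one is left, so each such step
lowers both sides of `hk` by one. -/
theorem exists_scopeNames_getD (k : ℕ) (vs : List ℕ)
    (hk : vs.length ≤ (List.range k).countP mask) (v : ℕ) (hv : v ∈ vs) :
    ∃ i < k, mask i = true ∧ (scopeNames mask b k vs).getD i 0 = v := by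
  induction k generalizing vs with
  | zero => simp_all
  | succ k ih =>
    rw [List.range_succ, List.countP_append, List.countP_singleton] at hk
    have hlift (vs' : List ℕ) (x : ℕ) (h : scopeNames mask b (k + 1) vs =
        scopeNames mask b k vs' ++ [x]) (hk : vs'.length ≤ (List.range k).countP mask)
        (hv : v ∈ vs') : ∃ i < k + 1, mask i = true ∧
          (scopeNames mask b (k + 1) vs).getD i 0 = v := by
      obtain ⟨i, hi, hm, e⟩ := ih vs' hk hv
      refine ⟨i, by omega, hm, ?_⟩
      rwa [h, List.getD_append _ _ _ _ (by rwa [length_scopeNames])]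
    rcases scopeNames_succ k vs with ⟨h, hm⟩ | ⟨x, vs', rfl, hm, h⟩
    · refine hlift vs _ h ?_ hv
      cases hmk : mask k
      · simpa [hmk] using hk
      · simp [hm hmk]
    · rcases List.mem_cons.1 hv with rfl | hv
      · refine ⟨k, by omega, hm, ?_⟩
        rw [h, List.getD_append_right _ _ _ _ (by rw [length_scopeNames])]
        simp [length_scopeNames]
      · exact hlift vs' x h (by simpa [hm] using hk) hv

theorem mem_scopeNames {k : ℕ} {vs : List ℕ} {x : ℕ} (h : x ∈ scopeNames mask b k vs) :
    x ∈ vs ∨ b ≤ x ∧ x < b + k := by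
  obtain ⟨i, hi, rfl⟩ := List.getElem_of_mem h
  rw [length_scopeNames] at hi
  rw [← List.getD_eq_getElem _ 0]
  rcases scopeNames_getD (mask := mask) (b := b) k vs i hi with h | h
  · rw [h]; omega
  · exact .inl h.2

/-- Vertices lie below `b` and new variables do not, and distinct positions get distinct new
variables. Degrees count multiplicity, so this is what limits each variable to one occurrence per
scope. -/
theorem scopeNames_nodup (k : ℕ) (vs : List ℕ) (hvs : vs.Nodup) (hb : ∀ v ∈ vs, v < b) :
    (scopeNames mask b k vs).Nodup := by
  induction k generalizing vs with
  | zero => exact List.nodup_nil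
  | succ k ih =>
    rcases scopeNames_succ (mask := mask) (b := b) k vs with ⟨h, -⟩ | ⟨v, vs', rfl, -, h⟩
    · rw [h, ← List.concat_eq_append]
      refine List.Nodup.concat (fun hm => ?_) (ih vs hvs hb)
      rcases mem_scopeNames hm with h | h
      · have := hb _ h; omega
      · omega
    · rw [List.nodup_cons] at hvs
      rw [h, ← List.concat_eq_append]
      refine List.Nodup.concat (fun hm => ?_)
        (ih vs' hvs.2 fun v h => hb v (List.mem_cons_of_mem _ h))
      rcases mem_scopeNames hm with h | h
      · exact hvs.1 h
      · have := hb v List.mem_cons_self; omega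

end

/-! ### The constraints: codes, distinctness and degrees -/

section

variable {r : ℕ} {R : Set (Fin r → Bool)}

/-- The constraint `R(s 0, …, s (r - 1))`. -/
def relCon (R : Set (Fin r → Bool)) (s : ℕ → ℕ) : Constraint (⟨r, R⟩ :: pins) ℕ :=
  ⟨⟨0, Nat.succ_pos _⟩, fun i => s i.val⟩

/-- The constraint that pins `v` to `c`. -/
def pinCon (R : Set (Fin r → Bool)) (c : Bool) (v : ℕ) : Constraint (⟨r, R⟩ :: pins) ℕ :=
  match c with
  | false => ⟨(1 : Fin 3), fun _ => v⟩
  | true => ⟨(2 : Fin 3), fun _ => v⟩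

theorem relCon_satisfied (s : ℕ → ℕ) (ρ : ℕ → Bool) :
    (relCon R s).Satisfied ρ ↔ (fun i : Fin r => ρ (s i)) ∈ R := Iff.rfl

theorem pinCon_satisfied (c : Bool) (v : ℕ) (ρ : ℕ → Bool) :
    (pinCon R c v).Satisfied ρ ↔ ρ v = c := by
  cases c <;> exact Iff.rfl

theorem relCon_natCode (s : ℕ → ℕ) :
    (relCon R s).natCode = rawCode 0 (List.ofFn fun i : Fin r => s i) := rfl

theorem pinCon_natCode (c : Bool) (v : ℕ) :
    (pinCon R c v).natCode = rawCode (pinName c) [v] := by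
  cases c <;> rfl

theorem pinCon_occ (c : Bool) (v x : ℕ) :
    (pinCon R c v).occ x = if v = x then 1 else 0 := by
  have : (Finset.univ.filter fun _ : Fin 1 => v = x).card = if v = x then 1 else 0 := by
    split_ifs with h <;> simp [h]
  cases c <;> exact this

theorem relCon_occ_le_one {l : List ℕ} (hl : l.length = r) (hnd : l.Nodup) (x : ℕ) :
    (relCon R fun i => l.getD i 0).occ x ≤ 1 := by
  refine Finset.card_le_one.2 fun i hi j hj => ?_
  change Fin r at i j
  have hi : l.getD i 0 = x := (Finset.mem_filter.1 hi).2
  have hj : l.getD j 0 = x := (Finset.mem_filter.1 hj).2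
  rw [List.getD_eq_getElem _ _ (by omega)] at hi hj
  exact Fin.ext ((hnd.getElem_inj_iff).1 (hi.trans hj.symm))

theorem relCon_occ_eq_zero {l : List ℕ} (hl : l.length = r) {x : ℕ} (hx : x ∉ l) :
    (relCon R fun i => l.getD i 0).occ x = 0 := by
  refine Finset.card_eq_zero.2 (Finset.filter_eq_empty_iff.2 fun i _ h => hx ?_)
  change Fin r at i
  have h : l.getD i 0 = x := h
  rw [List.getD_eq_getElem _ _ (by omega)] at h
  exact h ▸ List.getElem_mem _

theorem relCon_ne_pinCon (s : ℕ → ℕ) (c : Bool) (v : ℕ) : relCon R s ≠ pinCon R c v := by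
  intro h
  have := congrArg (fun c => c.name.val) h
  cases c <;> simp [relCon, pinCon] at this

theorem relCon_inj {s s' : ℕ → ℕ} (h : relCon R s = relCon R s') (i : ℕ) (hi : i < r) :
    s i = s' i := by
  simp only [relCon, Constraint.mk.injEq, true_and] at h
  exact congrFun (eq_of_heq h) ⟨i, hi⟩

theorem pinCon_inj {c c' : Bool} {v v' : ℕ} (h : pinCon R c v = pinCon R c' v') : v = v' := by
  -- Counting occurrences avoids comparing scopes whose types depend on the names of the relations.
  by_contra hne
  have := pinCon_occ (R := R) c v v
  rw [h, pinCon_occ, if_neg (Ne.symm hne)] at this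
  simp at this

variable (R) (mask p : ℕ → Bool)

/-- The pins of the variables `b, …, b + k - 1`. -/
def pinCons (b k : ℕ) : List (Constraint (⟨r, R⟩ :: pins) ℕ) :=
  (List.range k).map fun i => pinCon R (p i) (b + i)

/-- The constraint for a row of an incidence matrix. -/
def rowCon (bs : List Bool) (b : ℕ) : Constraint (⟨r, R⟩ :: pins) ℕ :=
  relCon R fun i => (scopeNames mask b r (truePositions bs 0)).getD i 0

/-- The constraints for the rows of an incidence matrix. -/
def rowsCons : List (List Bool) → ℕ → List (Constraint (⟨r, R⟩ :: pins) ℕ)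
  | [], _ => []
  | bs :: E, b => rowsCons E (b + r) ++ (pinCons R p b r ++ [rowCon R mask bs b])

/-- The link between the string that the machine writes and the instance whose solutions are
counted. -/
theorem flatMap_natCode_rowsCons (E : List (List Bool)) (b : ℕ) :
    (rowsCons R mask p E b).flatMap Constraint.natCode = rowsCode r mask p E b := by
  induction E generalizing b with
  | nil => rfl
  | cons bs E ih =>
    have h₁ : (pinCons R p b r).flatMap Constraint.natCode = pinsCode p b r := by
      simp only [pinCons, pinsCode, List.flatMap, List.map_map, Function.comp_def, pinCon_natCode]
    have h₂ : (rowCon R mask bs b).natCode =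
        rawCode 0 (scopeNames mask b r (truePositions bs 0)) := by
      rw [rowCon, relCon_natCode]
      congr 1
      refine List.ext_getElem (by simp [length_scopeNames]) fun i h _ => ?_
      rw [List.getElem_ofFn, List.getD_eq_getElem]
    rw [rowsCons, rowsCode, List.flatMap_append, List.flatMap_append, ih, h₁,
      List.flatMap_singleton, h₂]

variable {R mask p}

theorem mem_pinCons {b k : ℕ} {c : Constraint (⟨r, R⟩ :: pins) ℕ} :
    c ∈ pinCons R p b k ↔ ∃ i < k, pinCon R (p i) (b + i) = c := by
  simp [pinCons]

theorem pinCon_scope_lt {c : Bool} {v N : ℕ} (h : v < N) : ∀ i, (pinCon R c v).scope i < N := by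
  cases c <;> exact fun _ => h

theorem rowCon_scope_lt {n : ℕ} {bs : List Bool} (hbs : bs.length = n) {b N : ℕ} (hn : n ≤ N)
    (hb : b + r ≤ N) : ∀ i, (rowCon R mask bs b).scope i < N := by
  intro i
  change Fin r at i
  change (scopeNames mask b r (truePositions bs 0)).getD i 0 < N
  have hi := i.2
  rcases scopeNames_getD (mask := mask) (b := b) r (truePositions bs 0) i hi with h | ⟨-, h⟩
  · omega
  · have := lt_of_mem_truePositions h
    omega

theorem rowsCons_scope_lt {n : ℕ} {E : List (List Bool)} (hE : ∀ bs ∈ E, bs.length = n) {b N : ℕ}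
    (hn : n ≤ N) (hb : b + r * E.length ≤ N) :
    ∀ c ∈ rowsCons R mask p E b, ∀ i, c.scope i < N := by
  induction E generalizing b with
  | nil => simp [rowsCons]
  | cons bs E ih =>
    rw [List.length_cons, Nat.mul_succ] at hb
    intro c hc
    rw [rowsCons, List.mem_append, List.mem_append, List.mem_singleton] at hc
    rcases hc with hc | hc | rfl
    · exact ih (fun x hx => hE x (List.mem_cons_of_mem _ hx)) (by omega) c hc
    · obtain ⟨i, hi, rfl⟩ := mem_pinCons.1 hc
      exact pinCon_scope_lt (by omega)
    · exact rowCon_scope_lt (hE bs List.mem_cons_self) hn (by omega)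

theorem mem_rowsCons {E : List (List Bool)} {b : ℕ} {c : Constraint (⟨r, R⟩ :: pins) ℕ}
    (h : c ∈ rowsCons R mask p E b) : (∃ x v, b ≤ v ∧ c = pinCon R x v) ∨
      ∃ bs ∈ E, ∃ b', b ≤ b' ∧ c = rowCon R mask bs b' := by
  induction E generalizing b with
  | nil => simp [rowsCons] at h
  | cons bs E ih =>
    rw [rowsCons, List.mem_append, List.mem_append, List.mem_singleton] at h
    rcases h with h | h | rfl
    · rcases ih h with ⟨x, v, hv, rfl⟩ | ⟨bs', h', b', hb, rfl⟩
      · exact .inl ⟨x, v, by omega, rfl⟩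
      · exact .inr ⟨bs', List.mem_cons_of_mem _ h', b', by omega, rfl⟩
    · obtain ⟨i, hi, rfl⟩ := mem_pinCons.1 h
      exact .inl ⟨_, _, by omega, rfl⟩
    · exact .inr ⟨bs, List.mem_cons_self, b, le_rfl, rfl⟩

/-- The row can be recovered from its constraint. -/
theorem rowCon_inj {n : ℕ} {bs bs' : List Bool} {b b' : ℕ} (hbs : bs.length = n)
    (hbs' : bs'.length = n) (hb : n ≤ b) (hb' : n ≤ b')
    (hw : (truePositions bs 0).length ≤ (List.range r).countP mask)
    (hw' : (truePositions bs' 0).length ≤ (List.range r).countP mask)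
    (h : rowCon R mask bs b = rowCon R mask bs' b') : bs = bs' := by
  have key : ∀ {bs bs' : List Bool} {b b' : ℕ}, bs.length = n → n ≤ b' →
      (truePositions bs 0).length ≤ (List.range r).countP mask →
      rowCon R mask bs b = rowCon R mask bs' b' → ∀ v ∈ truePositions bs 0,
        v ∈ truePositions bs' 0 := by
    intro bs bs' b b' hbs hb' hw h v hv
    obtain ⟨i, hi, -, e⟩ := exists_scopeNames_getD (b := b) r _ hw v hv
    have hv := lt_of_mem_truePositions hv
    rw [relCon_inj h i hi] at e
    -- A vertex is less than `n ≤ b'`, so it cannot be one of the new variables of the other scope.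
    rcases scopeNames_getD (mask := mask) (b := b') r (truePositions bs' 0) i hi with h | ⟨-, h⟩
    · omega
    · exact e ▸ h
  exact truePositions_injective (hbs.trans hbs'.symm) fun v =>
    ⟨key hbs hb' hw h v, key hbs' hb hw' h.symm v⟩

theorem pinCons_nodup (b k : ℕ) : (pinCons R p b k).Nodup :=
  List.nodup_range.map fun i j h => by
    have := pinCon_inj h
    omega

theorem rowsCons_nodup {n : ℕ} {E : List (List Bool)} (hE : ∀ bs ∈ E, bs.length = n)
    (hw : ∀ bs ∈ E, (truePositions bs 0).length ≤ (List.range r).countP mask) (hnd : E.Nodup)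
    {b : ℕ} (hb : n ≤ b) : (rowsCons R mask p E b).Nodup := by
  induction E generalizing b with
  | nil => exact List.nodup_nil
  | cons bs E ih =>
    rw [List.nodup_cons] at hnd
    rw [List.forall_mem_cons] at hE hw
    refine (ih hE.2 hw.2 hnd.2 (by omega)).append ?_ fun c hc hc' => ?_
    · refine (pinCons_nodup b r).append (List.nodup_singleton _) fun c hc hc' => ?_
      rw [List.mem_singleton] at hc'
      obtain ⟨i, -, rfl⟩ := mem_pinCons.1 hc
      exact relCon_ne_pinCon _ _ _ hc'.symm
    · rw [List.mem_append, List.mem_singleton] at hc'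
      rcases mem_rowsCons hc with ⟨x, v, hv, rfl⟩ | ⟨bs', h', b', hb', rfl⟩
      · rcases hc' with hc' | hc'
        · obtain ⟨i, hi, e⟩ := mem_pinCons.1 hc'
          have := pinCon_inj e
          omega
        · exact relCon_ne_pinCon _ _ _ hc'.symm
      · rcases hc' with hc' | hc'
        · obtain ⟨i, hi, e⟩ := mem_pinCons.1 hc'
          exact relCon_ne_pinCon _ _ _ e.symm
        · have := rowCon_inj (hE.2 _ h') hE.1 (by omega) hb (hw.2 _ h') hw.1 hc'
          exact hnd.1 (this ▸ h')

theorem sum_occ_pinCons (b k x : ℕ) :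
    ((pinCons R p b k).map fun c => c.occ x).sum = if b ≤ x ∧ x < b + k then 1 else 0 := by
  induction k with
  | zero => simp [pinCons]
  | succ k ih =>
    rw [pinCons] at ih ⊢
    rw [List.range_succ, List.map_append, List.map_append, List.sum_append, ih]
    simp only [List.map_cons, List.map_nil, List.sum_singleton, pinCon_occ]
    split_ifs <;> omega

theorem rowCon_occ_le {n : ℕ} {bs : List Bool} (hbs : bs.length = n) {b : ℕ} (hb : n ≤ b) (x : ℕ) :
    (rowCon R mask bs b).occ x ≤ if x ∈ truePositions bs 0 ∨ b ≤ x ∧ x < b + r then 1 else 0 := by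
  have hl := length_scopeNames (mask := mask) (b := b) r (truePositions bs 0)
  split_ifs with h
  · exact relCon_occ_le_one hl (scopeNames_nodup r _ (truePositions_nodup bs 0) fun v hv => by
      have := lt_of_mem_truePositions hv; omega) x
  · exact (relCon_occ_eq_zero hl fun hx => h (mem_scopeNames hx)).le

/-- All new variables of these rows are at least `b`, so `x` can occur only as a vertex, once for
each row that contains it. -/
theorem sum_occ_rowsCons_of_lt {n : ℕ} {E : List (List Bool)} (hE : ∀ bs ∈ E, bs.length = n)
    {b x : ℕ} (hb : n ≤ b) (hx : x < b) : ((rowsCons R mask p E b).map fun c => c.occ x).sum ≤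
      E.countP fun bs => x ∈ truePositions bs 0 := by
  induction E generalizing b with
  | nil => simp [rowsCons]
  | cons bs E ih =>
    rw [List.forall_mem_cons] at hE
    have h₁ := ih hE.2 (b := b + r) (by omega) (by omega)
    have h₂ := rowCon_occ_le (R := R) (mask := mask) hE.1 hb x
    rw [rowsCons, List.map_append, List.map_append, List.sum_append, List.sum_append,
      sum_occ_pinCons, List.countP_cons, List.map_singleton, List.sum_singleton]
    simp only [decide_eq_true_eq] at h₁ ⊢
    split_ifs at h₂ ⊢ <;> grind

/-- A variable that is not a vertex belongs to the block of at most one row, where it has one pin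
and at most one place in the scope. -/
theorem sum_occ_rowsCons_of_le {n : ℕ} {E : List (List Bool)} (hE : ∀ bs ∈ E, bs.length = n)
    {b x : ℕ} (hb : n ≤ b) (hx : n ≤ x) :
    ((rowsCons R mask p E b).map fun c => c.occ x).sum ≤ 2 := by
  induction E generalizing b with
  | nil => simp [rowsCons]
  | cons bs E ih =>
    rw [List.forall_mem_cons] at hE
    have h₁ := ih hE.2 (b := b + r) (by omega)
    have h₂ := rowCon_occ_le (R := R) (mask := mask) hE.1 hb x
    have hx' : x ∉ truePositions bs 0 := fun h => by
      have := lt_of_mem_truePositions h; omega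
    have hz : ∀ bs ∈ E, x ∉ truePositions bs 0 := fun bs h h' => by
      have := lt_of_mem_truePositions h'
      have := hE.2 bs h
      omega
    rw [rowsCons, List.map_append, List.map_append, List.sum_append, List.sum_append,
      sum_occ_pinCons, List.map_singleton, List.sum_singleton]
    -- The blocks of the remaining rows start at `b + r`, so below that bound those rows contribute
    -- nothing.
    by_cases hxb : x < b + r
    · have h₃ := sum_occ_rowsCons_of_lt (R := R) (mask := mask) (p := p) hE.2 (b := b + r)
        (by omega) hxb
      rw [List.countP_eq_zero.2 (by simpa using hz)] at h₃
      split_ifs at h₂ ⊢ <;> omega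
    · rw [if_neg (by simp only [hx', false_or]; omega)] at h₂
      rw [if_neg (by omega)]
      omega

/-! ## Satisfying assignments -/

/-- With the positions off the mask set to `p`, the relation says that some masked position has the
value `t`, the opposite of what `p` prescribes there. -/
structure Simulates (R : Set (Fin r → Bool)) (mask p : ℕ → Bool) (t : Bool) : Prop where
  pin_mask : ∀ i, mask i = true → p i = !t
  mem_iff : ∀ a : Fin r → Bool, (∀ i : Fin r, mask i = false → a i = p i) →
    (a ∈ R ↔ ∃ i : Fin r, mask i = true ∧ a i = t)

theorem rowCon_satisfied {t : Bool} (hR : Simulates R mask p t) {bs : List Bool}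
    (hw : (truePositions bs 0).length ≤ (List.range r).countP mask) {b : ℕ} {ρ : ℕ → Bool}
    (hρ : ∀ i < r, ρ (b + i) = p i) :
    (rowCon R mask bs b).Satisfied ρ ↔ ∃ v ∈ truePositions bs 0, ρ v = t := by
  rw [rowCon, relCon_satisfied, hR.mem_iff]
  · constructor
    · rintro ⟨i, hm, h⟩
      rcases scopeNames_getD (mask := mask) (b := b) r (truePositions bs 0) i i.2 with e | ⟨-, e⟩
      -- A masked position left without a vertex carries a variable pinned to `!t`, so it cannot be
      -- the witness.
      · rw [e, hρ i i.2, hR.pin_mask i hm] at h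
        simp at h
      · exact ⟨_, e, h⟩
    · rintro ⟨v, hv, h⟩
      obtain ⟨i, hi, hm, e⟩ := exists_scopeNames_getD (mask := mask) (b := b) r _ hw v hv
      exact ⟨⟨i, hi⟩, hm, by rw [e, h]⟩
  · intro i hm
    rcases scopeNames_getD (mask := mask) (b := b) r (truePositions bs 0) i i.2 with e | ⟨h, -⟩
    · rw [e, hρ i i.2]
    · simp [hm] at h

/-- The blocks of new variables follow one another, each pinned by the same pattern, hence the index
`q % r`. Simulation is assumed only if there is a row, which lets width `0` through. -/
theorem rowsCons_satisfied {t : Bool} {E : List (List Bool)}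
    (hR : E ≠ [] → Simulates R mask p t)
    (hw : ∀ bs ∈ E, (truePositions bs 0).length ≤ (List.range r).countP mask) {b : ℕ}
    {ρ : ℕ → Bool} : (∀ c ∈ rowsCons R mask p E b, c.Satisfied ρ) ↔
      (∀ q < r * E.length, ρ (b + q) = p (q % r)) ∧
        ∀ bs ∈ E, ∃ v ∈ truePositions bs 0, ρ v = t := by
  induction E generalizing b with
  | nil => simp [rowsCons]
  | cons bs E ih =>
    rw [List.forall_mem_cons] at hw
    have hR := hR (List.cons_ne_nil _ _)
    have hpin : (∀ c ∈ pinCons R p b r, c.Satisfied ρ) ↔ ∀ i < r, ρ (b + i) = p i := by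
      constructor
      · intro h i hi
        exact (pinCon_satisfied _ _ _).1 (h _ (mem_pinCons.2 ⟨i, hi, rfl⟩))
      · intro h c hc
        obtain ⟨i, hi, rfl⟩ := mem_pinCons.1 hc
        exact (pinCon_satisfied _ _ _).2 (h i hi)
    have hsplit : (∀ q < r * (E.length + 1), ρ (b + q) = p (q % r)) ↔
        (∀ i < r, ρ (b + i) = p i) ∧ ∀ q < r * E.length, ρ (b + r + q) = p (q % r) := by
      rw [Nat.mul_succ]
      constructor
      · intro h
        refine ⟨fun i hi => ?_, fun q hq => ?_⟩
        · rw [h i (by omega), Nat.mod_eq_of_lt hi]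
        · rw [Nat.add_assoc, h _ (by omega), Nat.add_mod_left]
      · rintro ⟨h₁, h₂⟩ q hq
        rcases Nat.lt_or_ge q r with hqr | hqr
        · rw [h₁ q hqr, Nat.mod_eq_of_lt hqr]
        · obtain ⟨q, rfl⟩ := Nat.exists_eq_add_of_le hqr
          rw [← Nat.add_assoc, h₂ q (by omega), Nat.add_mod_left]
    simp only [rowsCons, List.forall_mem_append, List.forall_mem_singleton, List.forall_mem_cons,
      ih (fun _ => hR) hw.2, hpin, List.length_cons, hsplit]
    constructor
    · rintro ⟨⟨h₁, h₂⟩, h₃, h₄⟩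
      exact ⟨⟨h₃, h₁⟩, (rowCon_satisfied hR hw.1 h₃).1 h₄, h₂⟩
    · rintro ⟨⟨h₃, h₁⟩, h₄, h₂⟩
      exact ⟨⟨h₁, h₂⟩, h₃, (rowCon_satisfied hR hw.1 h₃).2 h₄⟩

end

/-! ## Relations of positive width -/

section

variable {r : ℕ}

/-- The relation defined by a formula when its clauses say that some argument has the value `t`. -/
def ConjFormula.relOf (t : Bool) (φ : ConjFormula r) : Set (Fin r → Bool) :=
  {a | (∀ q ∈ φ.pinned, a q.1 = q.2) ∧ ∀ C ∈ φ.clauses, ∃ i ∈ C, a i = t}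

theorem ConjFormula.nandRel_eq (φ : ConjFormula r) : φ.nandRel = φ.relOf false := by
  simp [nandRel, relOf]

theorem exists_mem_eq_foldr_max {l : List ℕ} (h : l.foldr max 0 ≠ 0) : l.foldr max 0 ∈ l := by
  induction l with
  | nil => exact absurd rfl h
  | cons x l ih =>
    rw [List.foldr_cons] at h ⊢
    rcases max_choice x (l.foldr max 0) with hx | hx <;> rw [hx] at h ⊢
    · exact List.mem_cons_self
    · exact List.mem_cons_of_mem _ (ih h)

/-- Isolates a widest clause: the antichain condition and the absence of pinned variables from
clauses let fixed values outside it satisfy everything else. -/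
theorem ConjFormula.Normalized.exists_simulates {φ : ConjFormula r} (hφ : φ.Normalized) (t : Bool)
    (hw : φ.width ≠ 0) : ∃ mask p : ℕ → Bool, Simulates (φ.relOf t) mask p t ∧
      φ.width ≤ (List.range r).countP mask := by
  classical
  obtain ⟨hpin, hdisj, hnd, -, hpair⟩ := hφ
  obtain ⟨C, hC, hCw⟩ := List.mem_map.1 (exists_mem_eq_foldr_max hw)
  let mask : ℕ → Bool := fun i => decide (∃ h : i < r, (⟨i, h⟩ : Fin r) ∈ C)
  let p : ℕ → Bool := fun i =>
    if (∃ h : i < r, (⟨i, h⟩ : Fin r) ∈ C) ∨ ∃ h : i < r, ((⟨i, h⟩ : Fin r), !t) ∈ φ.pinned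
    then !t else t
  have hmask (i : Fin r) : mask i = true ↔ i ∈ C := by simp [mask]
  have hp (i : Fin r) (hi : i ∉ C) : p i = if (i, !t) ∈ φ.pinned then !t else t := by
    simp [p, hi]
  refine ⟨mask, p, ⟨fun i hi => if_pos (.inl (of_decide_eq_true hi)), fun a ha => ?_⟩, ?_⟩
  · have ha (i : Fin r) (hi : i ∉ C) : a i = if (i, !t) ∈ φ.pinned then !t else t := by
      rw [ha i (Bool.eq_false_iff.2 (mt (hmask i).1 hi)), hp i hi]
    simp only [hmask]
    refine ⟨fun h => h.2 C hC, fun ⟨i₀, hi₀, hit⟩ => ⟨fun q hq => ?_, fun D hD => ?_⟩⟩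
    · obtain ⟨i, c⟩ := q
      rw [ha i (hdisj _ hq C hC)]
      have := hpin i
      -- A pin to `!t` is what `p` looks for; under a pin to `t`, consistency of the pins makes `p`
      -- take its default `t`.
      cases c <;> cases t <;> simp_all
    · by_cases hDC : D = C
      · exact hDC ▸ ⟨i₀, hi₀, hit⟩
      · have : Std.Symm fun C D : List (Fin r) => ¬ C ⊆ D ∧ ¬ D ⊆ C := ⟨fun _ _ h => ⟨h.2, h.1⟩⟩
        have := hpair.forall hD hC hDC
        obtain ⟨i, hiD, hiC⟩ : ∃ i ∈ D, i ∉ C := by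
          by_contra! h
          exact this.1 h
        refine ⟨i, hiD, ?_⟩
        -- As an argument of `D`, the position `i` is not pinned, so its value is `t`.
        rw [ha i hiC, if_neg fun h => hdisj _ h D hD hiD]
  · rw [ConjFormula.width, ← hCw, List.countP_eq_length_filter, ← List.length_map (f := Fin.val)]
    refine (((hnd C hC).map Fin.val_injective).subperm fun i hi => ?_).length_le
    obtain ⟨j, hj, rfl⟩ := List.mem_map.1 hi
    simp [hmask, hj]

theorem exists_simulates (R : Set (Fin r → Bool)) (w : ℕ) (hR : orWidth R = w ∨ nandWidth R = w) :
    ∃ (mask p : ℕ → Bool) (t : Bool), w ≠ 0 → Simulates R mask p t ∧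
      w ≤ (List.range r).countP mask := by
  rcases eq_or_ne w 0 with hw | hw
  · exact ⟨fun _ => false, fun _ => false, false, fun h => absurd hw h⟩
  rcases hR with rfl | rfl
  -- The infimum of the empty set is `0`, so a nonzero width is attained by a normalized formula.
  · obtain ⟨φ, hφ, hφR, h⟩ := Nat.sInf_mem (Nat.nonempty_of_pos_sInf (Nat.pos_of_ne_zero hw))
    obtain ⟨mask, p, h₁, h₂⟩ := hφ.exists_simulates true (h ▸ hw)
    exact ⟨mask, p, true, fun _ => ⟨hφR ▸ h₁, h.symm.trans_le h₂⟩⟩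
  · obtain ⟨φ, hφ, hφR, h⟩ := Nat.sInf_mem (Nat.nonempty_of_pos_sInf (Nat.pos_of_ne_zero hw))
    obtain ⟨mask, p, h₁, h₂⟩ := hφ.exists_simulates false (h ▸ hw)
    exact ⟨mask, p, false, fun _ => ⟨hφR ▸ φ.nandRel_eq ▸ h₁, h.symm.trans_le h₂⟩⟩

end

/-! ## Incidence matrices -/

/-- The incidence vector of a hyperedge. -/
def incidence {n : ℕ} (e : Finset (Fin n)) : List Bool := List.ofFn fun v => decide (v ∈ e)

theorem rowCode_incidence {n : ℕ} (e : Finset (Fin n)) : rowCode (incidence e) = edgeCode e := by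
  rw [rowCode, incidence, List.map_ofFn]
  rfl

theorem mem_truePositions_incidence {n : ℕ} {e : Finset (Fin n)} {v : ℕ} :
    v ∈ truePositions (incidence e) 0 ↔ ∃ h : v < n, ⟨v, h⟩ ∈ e := by
  simp [mem_truePositions, incidence, List.getElem?_ofFn]

theorem length_truePositions_incidence {n : ℕ} (e : Finset (Fin n)) :
    (truePositions (incidence e) 0).length = e.card := by
  rw [← List.toFinset_card_of_nodup (truePositions_nodup _ _), ← Finset.card_map Fin.valEmbedding]
  congr 1
  ext v
  simp only [List.mem_toFinset, mem_truePositions_incidence, Finset.mem_map, Fin.valEmbedding_apply]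
  exact ⟨fun ⟨h, hv⟩ => ⟨_, hv, rfl⟩, by rintro ⟨v, hv, rfl⟩; exact ⟨v.2, hv⟩⟩

theorem incidence_injective {n : ℕ} : Function.Injective (incidence (n := n)) := by
  intro e e' h
  ext v
  have := congrArg (fun l => v.val ∈ truePositions l 0) h
  simpa [mem_truePositions_incidence] using this

/-! ### From a hypergraph to its CSP instance -/

namespace HISInstance

variable {w d : ℕ} (H : HISInstance w d)

/-- The incidence matrix. -/
def matrix : List (List Bool) := H.edges.map incidence

theorem code_eq : H.code = ones H.n ++ .bar :: H.matrix.flatMap rowCode := by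
  simp only [code, matrix, List.flatMap_map, rowCode_incidence]

theorem length_of_mem_matrix : ∀ bs ∈ H.matrix, bs.length = H.n := by
  simp [matrix, incidence]

theorem card_le {e : Finset (Fin H.n)} (he : e ∈ H.edges) : e.card ≤ w := by
  simpa using H.width_le e ⟨e, he, rfl⟩

theorem length_truePositions_le : ∀ bs ∈ H.matrix, (truePositions bs 0).length ≤ w := by
  intro bs hbs
  obtain ⟨e, he, rfl⟩ := List.mem_map.1 hbs
  exact (length_truePositions_incidence e).trans_le (H.card_le he)

theorem width_ne_zero (h : H.matrix ≠ []) : w ≠ 0 := by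
  obtain ⟨bs, hbs⟩ := List.exists_mem_of_ne_nil _ h
  obtain ⟨e, he, rfl⟩ := List.mem_map.1 hbs
  have h₁ := H.nonempty e ⟨e, he, rfl⟩
  have h₂ := H.card_le he
  have := Finset.card_pos.2 (Finset.coe_nonempty.1 h₁)
  omega

theorem matrix_nodup : H.matrix.Nodup := H.nodup.map incidence_injective

theorem countP_matrix_le (x : ℕ) :
    (H.matrix.countP fun bs => x ∈ truePositions bs 0) ≤ d := by
  by_cases hx : x < H.n
  · refine le_trans (le_of_eq ?_) (H.degree_le ⟨x, hx⟩)
    -- The list of hyperedges has no repetitions, so counting list entries agrees with the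
    -- cardinality that defines the degree.
    have hset : {e ∈ (listedHypergraph H.edges).edgeSet | (⟨x, hx⟩ : Fin H.n) ∈ e} =
        (fun e : Finset (Fin H.n) => (e : Set (Fin H.n))) ''
          (H.edges.filter fun e => ⟨x, hx⟩ ∈ e).toFinset := by
      ext s
      simp only [listedHypergraph, Set.mem_ofPred_eq, Set.mem_image, List.coe_toFinset,
        List.mem_filter, decide_eq_true_eq]
      constructor
      · rintro ⟨⟨e, he, rfl⟩, hv⟩
        exact ⟨e, ⟨he, hv⟩, rfl⟩
      · rintro ⟨e, ⟨he, hv⟩, rfl⟩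
        exact ⟨⟨e, he, rfl⟩, hv⟩
    rw [hdegree, hset, Set.ncard_image_of_injective _ Finset.coe_injective, Set.ncard_coe_finset,
      List.toFinset_card_of_nodup (H.nodup.filter _), matrix, List.countP_map,
      List.countP_eq_length_filter]
    congr 2
    funext e
    simp [mem_truePositions_incidence, hx]
  · rw [List.countP_eq_zero.2 fun bs hbs => ?_]
    · exact Nat.zero_le d
    · have := H.length_of_mem_matrix bs hbs
      intro h
      have := lt_of_mem_truePositions (of_decide_eq_true h)
      omega

variable {r : ℕ} {R : Set (Fin r → Bool)} {mask p : ℕ → Bool} {t : Bool}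

theorem truePositions_le_countP (hR : w ≠ 0 → Simulates R mask p t ∧
    w ≤ (List.range r).countP mask) :
    ∀ bs ∈ H.matrix, (truePositions bs 0).length ≤ (List.range r).countP mask := fun bs hbs =>
  (H.length_truePositions_le bs hbs).trans
    (hR (H.width_ne_zero (List.ne_nil_of_mem hbs))).2

/-- The instance of `#CSP_d({R} ∪ Γ_pin)` that has as many satisfying assignments as there are
independent sets. -/
def toCSP (hR : w ≠ 0 → Simulates R mask p t ∧ w ≤ (List.range r).countP mask) (hd : 2 ≤ d) :
    CSPInstance d (⟨r, R⟩ :: pins) :=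
  .ofNat (H.n + r * H.matrix.length) (rowsCons R mask p H.matrix H.n)
    (rowsCons_scope_lt H.length_of_mem_matrix (Nat.le_add_right _ _) le_rfl)
    (rowsCons_nodup H.length_of_mem_matrix (H.truePositions_le_countP hR) H.matrix_nodup le_rfl)
    fun x => by
      rcases Nat.lt_or_ge x H.n with hx | hx
      · exact (sum_occ_rowsCons_of_lt H.length_of_mem_matrix le_rfl hx).trans (H.countP_matrix_le x)
      · exact (sum_occ_rowsCons_of_le H.length_of_mem_matrix le_rfl hx).trans hd

variable (hR : w ≠ 0 → Simulates R mask p t ∧ w ≤ (List.range r).countP mask) (hd : 2 ≤ d)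

theorem code_toCSP : (H.toCSP hR hd).code =
    ones (H.n + r * H.matrix.length) ++ .bar :: rowsCode r mask p H.matrix H.n := by
  rw [toCSP, CSPInstance.code_ofNat, flatMap_natCode_rowsCons]

theorem isIndependent_iff (S : Set (Fin H.n)) : IsIndependent (listedHypergraph H.edges) S ↔
    ∀ e ∈ H.edges, ∃ v ∈ e, v ∉ S := by
  constructor
  · intro h e he
    obtain ⟨v, hv, hvS⟩ := Set.not_subset.1 (h.2 e ⟨e, he, rfl⟩)
    exact ⟨v, hv, hvS⟩
  · rintro h
    refine ⟨Set.subset_univ S, ?_⟩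
    rintro _ ⟨e, he, rfl⟩
    obtain ⟨v, hv, hvS⟩ := h e he
    exact Set.not_subset.2 ⟨v, hv, hvS⟩

theorem exists_matrix_iff {P : ℕ → Prop} : (∀ bs ∈ H.matrix, ∃ v ∈ truePositions bs 0, P v) ↔
    ∀ e ∈ H.edges, ∃ v ∈ e, P v := by
  simp only [matrix, List.forall_mem_map, mem_truePositions_incidence]
  exact forall₂_congr fun e _ => ⟨fun ⟨v, ⟨h, hv⟩, hP⟩ => ⟨⟨v, h⟩, hv, hP⟩,
    fun ⟨v, hv, hP⟩ => ⟨v, ⟨v.2, hv⟩, hP⟩⟩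

theorem Z_toCSP : (H.toCSP hR hd).Z = H.count := by
  rw [toCSP, CSPInstance.Z_ofNat, count]
  have hsat (ρ : ℕ → Bool) := rowsCons_satisfied (b := H.n) (ρ := ρ)
    (fun h => (hR (H.width_ne_zero h)).1) (H.truePositions_le_countP hR)
  simp only [H.exists_matrix_iff] at hsat
  simp only [hsat, H.isIndependent_iff]
  have hext {N : ℕ} (τ : Fin N → Bool) (v : Fin N) : extend τ v = τ v := dif_pos v.2
  -- For OR the independent set consists of the vertices with value false, for NAND of those with
  -- value true.
  refine Set.ncard_congr (fun τ _ => {v | extend τ v ≠ t}) ?_ ?_ ?_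
  · rintro τ ⟨-, h⟩ e he
    obtain ⟨v, hv, ht⟩ := h e he
    exact ⟨v, hv, fun h => h ht⟩
  · rintro τ τ' ⟨h, -⟩ ⟨h', -⟩ e
    funext v
    rw [← hext τ, ← hext τ']
    rcases Nat.lt_or_ge v H.n with hv | hv
    · have := Set.ext_iff.1 e ⟨v, hv⟩
      simp only [Set.mem_ofPred_eq, ne_eq, not_iff_not] at this
      cases t <;> cases h₁ : extend τ v <;> cases h₂ : extend τ' v <;> simp_all
    -- Outside the vertices both assignments are forced by the pins.
    · obtain ⟨q, hq⟩ := Nat.exists_eq_add_of_le hv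
      have := v.2
      rw [hq, h q (by omega), h' q (by omega)]
  · classical
    intro S hS
    -- The preimage of `S`: vertices are read off from `S`, and new variables take the values
    -- prescribed by their pins.
    let ρ : ℕ → Bool := fun v =>
      if h : v < H.n then (if (⟨v, h⟩ : Fin H.n) ∈ S then !t else t) else p ((v - H.n) % r)
    let τ : Fin (H.n + r * H.matrix.length) → Bool := fun v => ρ v
    have hτ (v : ℕ) (hv : v < H.n + r * H.matrix.length) : extend τ v = ρ v := dif_pos hv
    have hvert (v : Fin H.n) : extend τ v = if v ∈ S then !t else t := by
      rw [hτ v (by omega)]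
      simp [ρ]
    refine ⟨τ, ⟨fun q hq => ?_, fun e he => ?_⟩, ?_⟩
    · rw [hτ _ (by omega)]
      simp [ρ]
    · obtain ⟨v, hv, hvS⟩ := hS e he
      exact ⟨v, hv, by rw [hvert, if_neg hvS]⟩
    · ext v
      rw [Set.mem_ofPred_eq, hvert]
      by_cases h : v ∈ S <;> simp [h]

end HISInstance

end BoundedCSP

theorem mainTheorem8 {r : ℕ} (R : Set (Fin r → Bool)) (w d : ℕ)
    (hR : (R ∈ BoundedCSP.ORConj r ∧ BoundedCSP.orWidth R = w) ∨
      (R ∈ BoundedCSP.NANDConj r ∧ BoundedCSP.nandWidth R = w))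
    (hd : 2 ≤ d) :
    BoundedCSP.APReducible (BoundedCSP.numHIS w d)
      (BoundedCSP.numCSP d (⟨r, R⟩ :: BoundedCSP.pins)) := by
  obtain ⟨mask, p, t, hRt⟩ :=
    BoundedCSP.exists_simulates R w (hR.imp And.right And.right)
  refine ⟨BoundedCSP.reduction r mask p, BoundedCSP.isAPReduction_of_parsimonious _ _ _
    (fun H : BoundedCSP.HISInstance w d => H.toCSP hRt hd) (fun H => H.Z_toCSP hRt hd)
    .ask .final rfl rfl rfl (40 * (r + 1) ^ 2) fun H e => ?_⟩
  change BoundedCSP.HISInstance w d at H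
  refine ⟨BoundedCSP.cfg r mask p .ask (BoundedCSP.store [] e [] [] [] _), rfl,
    (H.code_toCSP hRt hd).symm, rfl, ?_⟩
  have := BoundedCSP.reach_ask (r := r) (mask := mask) (p := p) H.n H.matrix
    H.length_of_mem_matrix e
  rw [← H.code_eq] at this
  exact this
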